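/- Let $G=(V,E)$ be a finite simple undirected graph with $V\neq\emptyset$ and let $w:V\to\mathbb{R}_{>0}$ be vertex weights. For $C\subseteq V$ let $E(C)$ be the set of edges with both endpoints in $C$ and $w(C)=\sum_{v\in C}w(v)$. A clustering $\mathcal C$ of $G$ is a partition of $V$ into nonempty sets, and for $\lambda\in\mathbb{R}$ its objective value is $$Q^\lambda_w(\mathcal C)=\sum_{C\in\mathcal C}\left(\lambda+\frac{2|E(C)|}{w(C)}\right).$$ Let $\mathrm{Opt}^\lambda_G$ be a clustering that maximizes $Q^\lambda_w$. **Theorem.** For every $\lambda\in[0,1]$ there is a randomized algorithm that, given $(G,w)$, always halts and outputs a clustering $\mathcal C$ of $G$ with $$\tfrac1{169}\,Q^\lambda_w(\mathrm{Opt}^\lambda_G)\;\le\;\mathbb{E}\left[Q^\lambda_w(\mathcal C)\right]\;\le\;Q^\lambda_w(\mathrm{Opt}^\lambda_G).$$ The algorithm runs in $O(|V|+|E|\log|V|)$ time for arbitrary positive real weights. If the weights are given as integers in $[1,\mathrm{poly}(|V|)]$, it runs in linear time: for every $c$ its running time on graphs with integer weights in $[1,c|V|^c]$ is $O(|V|+|E|)$,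 where the constant may depend on $c$. Running times are worst-case over the random bits, on a random-access machine with words of $O(\log |V|)$ bits (for integer weights the constant may depend on $c$), exact real registers and arrays (arithmetic and comparisons, no rounding of reals to words), fair coin flips, and unit cost for every operation; the graph is given by $|V|$ and its list of edges, and $\lambda$ is available in a real register. -/

import Mathlib

open MeasureTheory

namespace GraphClustering

/-! ### The objective -/

section Objective

variable {V : Type*} [Fintype V] [DecidableEq V]

open Classical in
/-- `E(C)`: the edges of `G` both of whose endpoints lie in `C`. -/
noncomputable def innerEdges (G : SimpleGraph V) (C : Finset V) : Finset (Sym2 V) :=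
  Finset.univ.filter fun e => e ∈ G.edgeSet ∧ ∀ v ∈ e, v ∈ C

/-- The quality `q_w(C) = 2 |E(C)| / w(C)` of a set of vertices. -/
noncomputable def quality (G : SimpleGraph V) (w : V → ℝ) (C : Finset V) : ℝ :=
  2 * ((innerEdges G C).card : ℝ) / ∑ v ∈ C, w v

/-- A clustering is a partition of the vertex set into nonempty sets. -/
abbrev Clustering (V : Type*) [Fintype V] [DecidableEq V] : Type _ :=
  Finpartition (Finset.univ : Finset V)

/-- The objective `Q^lam_w(P) = ∑_{C ∈ P} (lam + q_w(C))`. -/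
noncomputable def objective (G : SimpleGraph V) (w : V → ℝ) (lam : ℝ) (P : Clustering V) : ℝ :=
  ∑ C ∈ P.parts, (lam + quality G w C)

/-- `P` maximizes `Q^lam_w` over all clusterings. -/
def IsOptimal (G : SimpleGraph V) (w : V → ℝ) (lam : ℝ) (P : Clustering V) : Prop :=
  ∀ P' : Clustering V, objective G w lam P' ≤ objective G w lam P

end Objective

/-! ### The machine: a randomized real RAM

A program is a finite structured program over finitely many word registers, real registers,
word arrays and real arrays (all named by natural numbers).  Words are natural numbers below a
bound `W`; a computed word that is not below `W` is a fault, and a fault leaves the program without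
an execution.  Reals are exact and can be added, subtracted, multiplied, divided and compared, and
a word can be converted to a real, but there is no conversion from reals to words (no floor).
Every elementary operation, memory access, comparison and coin flip costs one step. -/

/-- Word-valued expressions. -/
inductive NExp : Type
  | lit (k : ℕ)
  | reg (x : ℕ)
  | get (a : ℕ) (i : NExp)
  | add (e f : NExp)
  | sub (e f : NExp)
  | mul (e f : NExp)
  | div (e f : NExp)
  | mod (e f : NExp)

/-- Real-valued expressions. -/
inductive RExp : Type
  | ofWord (e : NExp)
  | reg (x : ℕ)
  | get (a : ℕ) (i : NExp)
  | add (e f : RExp)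
  | sub (e f : RExp)
  | mul (e f : RExp)
  | div (e f : RExp)

/-- Tests. -/
inductive BExp : Type
  | nlt (e f : NExp)
  | neq (e f : NExp)
  | rlt (e f : RExp)
  | not (b : BExp)
  | and (b c : BExp)

/-- Programs. -/
inductive Cmd : Type
  | skip
  | setN (x : ℕ) (e : NExp)
  | setR (x : ℕ) (e : RExp)
  | storeN (a : ℕ) (i e : NExp)
  | storeR (a : ℕ) (i : NExp) (e : RExp)
  | flip (x : ℕ)
  | seq (p q : Cmd)
  | ite (b : BExp) (p q : Cmd)
  | loop (b : BExp) (p : Cmd)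

/-- The contents of the memory, together with the number of coins flipped so far. -/
structure State : Type where
  nreg : ℕ → ℕ
  narr : ℕ → ℕ → ℕ
  rreg : ℕ → ℝ
  rarr : ℕ → ℕ → ℝ
  pos : ℕ

/-- `k` if it fits into a word, a fault otherwise. -/
def fit (W k : ℕ) : Option ℕ := if k < W then some k else none

/-- The value of a word expression (`none` is a fault).  Subtraction is truncated at `0`;
division is integer division, and dividing by `0` is a fault. -/
def NExp.eval (W : ℕ) (s : State) : NExp → Option ℕ
  | .lit k => fit W k
  | .reg x => some (s.nreg x)
  | .get a i => (i.eval W s).map (s.narr a)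
  | .add e f => (e.eval W s).bind fun x => (f.eval W s).bind fun y => fit W (x + y)
  | .sub e f => (e.eval W s).bind fun x => (f.eval W s).bind fun y => fit W (x - y)
  | .mul e f => (e.eval W s).bind fun x => (f.eval W s).bind fun y => fit W (x * y)
  | .div e f => (e.eval W s).bind fun x => (f.eval W s).bind fun y =>
      if y = 0 then none else fit W (x / y)
  | .mod e f => (e.eval W s).bind fun x => (f.eval W s).bind fun y =>
      if y = 0 then none else fit W (x % y)

open Classical in
/-- The value of a real expression (`none` is a fault; dividing by `0` is a fault). -/
noncomputable def RExp.eval (W : ℕ) (s : State) : RExp → Option ℝ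
  | .ofWord e => (e.eval W s).map fun k => (k : ℝ)
  | .reg x => some (s.rreg x)
  | .get a i => (i.eval W s).map (s.rarr a)
  | .add e f => (e.eval W s).bind fun x => (f.eval W s).map fun y => x + y
  | .sub e f => (e.eval W s).bind fun x => (f.eval W s).map fun y => x - y
  | .mul e f => (e.eval W s).bind fun x => (f.eval W s).map fun y => x * y
  | .div e f => (e.eval W s).bind fun x => (f.eval W s).bind fun y =>
      if y = 0 then none else some (x / y)

open Classical in
/-- The truth value of a test (`none` is a fault). -/
noncomputable def BExp.eval (W : ℕ) (s : State) : BExp → Option Bool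
  | .nlt e f => (e.eval W s).bind fun x => (f.eval W s).map fun y => decide (x < y)
  | .neq e f => (e.eval W s).bind fun x => (f.eval W s).map fun y => decide (x = y)
  | .rlt e f => (e.eval W s).bind fun x => (f.eval W s).map fun y => decide (x < y)
  | .not b => (b.eval W s).map fun x => !x
  | .and b c => (b.eval W s).bind fun x => (c.eval W s).map fun y => x && y

/-- The number of steps taken by the evaluation of a word expression: its number of nodes. -/
def NExp.cost : NExp → ℕ
  | .lit _ => 1
  | .reg _ => 1
  | .get _ i => i.cost + 1
  | .add e f => e.cost + f.cost + 1
  | .sub e f => e.cost + f.cost + 1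
  | .mul e f => e.cost + f.cost + 1
  | .div e f => e.cost + f.cost + 1
  | .mod e f => e.cost + f.cost + 1

/-- The number of steps taken by the evaluation of a real expression. -/
def RExp.cost : RExp → ℕ
  | .ofWord e => e.cost + 1
  | .reg _ => 1
  | .get _ i => i.cost + 1
  | .add e f => e.cost + f.cost + 1
  | .sub e f => e.cost + f.cost + 1
  | .mul e f => e.cost + f.cost + 1
  | .div e f => e.cost + f.cost + 1

/-- The number of steps taken by the evaluation of a test. -/
def BExp.cost : BExp → ℕ
  | .nlt e f => e.cost + f.cost + 1
  | .neq e f => e.cost + f.cost + 1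
  | .rlt e f => e.cost + f.cost + 1
  | .not b => b.cost + 1
  | .and b c => b.cost + c.cost + 1

/-- Write `k` into word register `x`. -/
def State.putN (s : State) (x k : ℕ) : State :=
  { s with nreg := Function.update s.nreg x k }

/-- Write `r` into real register `x`. -/
noncomputable def State.putR (s : State) (x : ℕ) (r : ℝ) : State :=
  { s with rreg := Function.update s.rreg x r }

/-- Write `k` into cell `i` of word array `a`. -/
def State.putNArr (s : State) (a i k : ℕ) : State :=
  { s with narr := Function.update s.narr a (Function.update (s.narr a) i k) }

/-- Write `r` into cell `i` of real array `a`. -/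
noncomputable def State.putRArr (s : State) (a i : ℕ) (r : ℝ) : State :=
  { s with rarr := Function.update s.rarr a (Function.update (s.rarr a) i r) }

/-- `Exec W ω p s t s'`: with word bound `W` and coin tosses `ω`, the program `p`, started in the
state `s`, halts after exactly `t` steps in the state `s'`. -/
inductive Exec (W : ℕ) (ω : ℕ → Bool) : Cmd → State → ℕ → State → Prop
  | skip (s : State) : Exec W ω .skip s 1 s
  | setN {s : State} {x : ℕ} {e : NExp} {k : ℕ} (he : e.eval W s = some k) :
      Exec W ω (.setN x e) s (e.cost + 1) (s.putN x k)
  | setR {s : State} {x : ℕ} {e : RExp} {r : ℝ} (he : e.eval W s = some r) :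
      Exec W ω (.setR x e) s (e.cost + 1) (s.putR x r)
  | storeN {s : State} {a : ℕ} {i e : NExp} {j k : ℕ}
      (hi : i.eval W s = some j) (he : e.eval W s = some k) :
      Exec W ω (.storeN a i e) s (i.cost + e.cost + 1) (s.putNArr a j k)
  | storeR {s : State} {a : ℕ} {i : NExp} {e : RExp} {j : ℕ} {r : ℝ}
      (hi : i.eval W s = some j) (he : e.eval W s = some r) :
      Exec W ω (.storeR a i e) s (i.cost + e.cost + 1) (s.putRArr a j r)
  | flip (s : State) (x : ℕ) :
      Exec W ω (.flip x) s 1 { s.putN x (if ω s.pos then 1 else 0) with pos := s.pos + 1 }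
  | seq {p q : Cmd} {s s' s'' : State} {t t' : ℕ}
      (hp : Exec W ω p s t s') (hq : Exec W ω q s' t' s'') :
      Exec W ω (.seq p q) s (t + t') s''
  | iteTrue {b : BExp} {p q : Cmd} {s s' : State} {t : ℕ}
      (hb : b.eval W s = some true) (hp : Exec W ω p s t s') :
      Exec W ω (.ite b p q) s (b.cost + 1 + t) s'
  | iteFalse {b : BExp} {p q : Cmd} {s s' : State} {t : ℕ}
      (hb : b.eval W s = some false) (hq : Exec W ω q s t s') :
      Exec W ω (.ite b p q) s (b.cost + 1 + t) s'
  | loopDone {b : BExp} {p : Cmd} {s : State} (hb : b.eval W s = some false) :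
      Exec W ω (.loop b p) s (b.cost + 1) s
  | loopStep {b : BExp} {p : Cmd} {s s' s'' : State} {t t' : ℕ}
      (hb : b.eval W s = some true) (hp : Exec W ω p s t s')
      (hl : Exec W ω (.loop b p) s' t' s'') :
      Exec W ω (.loop b p) s (b.cost + 1 + t + t') s''

/-- The probability space of an infinite sequence of independent fair coin tosses. -/
noncomputable def coinMeasure : Measure (ℕ → Bool) :=
  Measure.infinitePi fun _ : ℕ => (PMF.uniformOfFintype Bool).toMeasure

/-! ### Input, output and the guarantee -/

/-- The weights as they are given to the machine: as reals, or as machine words. -/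
inductive Weights (n : ℕ) : Type
  | reals (w : Fin n → ℝ)
  | words (w : Fin n → ℕ)

/-- The weight function that is represented. -/
def Weights.value {n : ℕ} : Weights n → Fin n → ℝ
  | .reals w => w
  | .words w => fun v => (w v : ℝ)

/-- `l` lists every edge of `G` exactly once, in an arbitrary order and with an arbitrary
orientation of each edge. -/
def IsEdgeList {n : ℕ} (G : SimpleGraph (Fin n)) (l : List (Fin n × Fin n)) : Prop :=
  (l.map fun p => s(p.1, p.2)).Nodup ∧
    ∀ e : Sym2 (Fin n), e ∈ (l.map fun p => s(p.1, p.2)) ↔ e ∈ G.edgeSet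

/-- The content of an array of length `n`, padded by `0`. -/
def padded {α : Type*} [Zero α] {n : ℕ} (f : Fin n → α) (i : ℕ) : α :=
  if h : i < n then f ⟨i, h⟩ else 0

/-- The initial state.  Word registers `0`, `1`, `2` hold the number of vertices, the number of
edges, and a flag that is `1` if the weights are given as words and `0` if they are given as reals.
Word arrays `0` and `1` hold the endpoints of the edges.  The weights are in word array `2` or in
real array `0`, according to the flag.  Real register `0` holds the parameter `lam`.  Everything
else is `0`, and no coin has been flipped. -/
noncomputable def start {n : ℕ} (lam : ℝ) (l : List (Fin n × Fin n)) (w : Weights n) : State where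
  nreg := fun x => match x, w with
    | 0, _ => n
    | 1, _ => l.length
    | 2, .words _ => 1
    | _, _ => 0
  narr := fun a => match a, w with
    | 0, _ => padded fun i : Fin l.length => ((l.get i).1 : ℕ)
    | 1, _ => padded fun i : Fin l.length => ((l.get i).2 : ℕ)
    | 2, .words f => padded f
    | _, _ => fun _ => 0
  rreg := fun x => if x = 0 then lam else 0
  rarr := fun a => match a, w with
    | 0, .reals f => padded f
    | _, _ => fun _ => 0
  pos := 0

/-- In the state `s`, word array `3` holds the clustering `P`: its cell `v` holds the label, in
`{0, …, n - 1}`, of the cluster of the vertex `v`. -/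
def Holds {n : ℕ} (s : State) (P : Clustering (Fin n)) : Prop :=
  (∀ v : Fin n, s.narr 3 v < n) ∧
    ∀ u v : Fin n, s.narr 3 u = s.narr 3 v ↔ ∃ C ∈ P.parts, u ∈ C ∧ v ∈ C

/-- With word bound `W`, the program `p` computes, from the graph `G` given by the edge list `l` and
with the weights `w`, a random clustering `A`; it always halts within `T` steps without a fault, and
the expected value of the objective lies between `α` times the optimum and the optimum. -/
def Approximates {n : ℕ} (p : Cmd) (lam α : ℝ) (G : SimpleGraph (Fin n))
    (l : List (Fin n × Fin n)) (w : Weights n) (W : ℕ) (T : ℝ) : Prop :=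
  ∃ A : (ℕ → Bool) → Clustering (Fin n),
    (∀ ω : ℕ → Bool, ∃ (t : ℕ) (s : State),
      Exec W ω p (start lam l w) t s ∧ (t : ℝ) ≤ T ∧ Holds s (A ω)) ∧
    Integrable (fun ω => objective G w.value lam (A ω)) coinMeasure ∧
    ∃ Opt : Clustering (Fin n), IsOptimal G w.value lam Opt ∧
      α * objective G w.value lam Opt ≤ ∫ ω, objective G w.value lam (A ω) ∂coinMeasure ∧
      ∫ ω, objective G w.value lam (A ω) ∂coinMeasure ≤ objective G w.value lam Opt

end GraphClustering

/-! A system of stars is an idempotent map `f` on the vertices: `f v` is the centre of the star of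
`v`, and the fibres of `f` are the clusters. Write `k u` for the number of leaves of `u`, and `S`
for the sum of `k u / w u` over all vertices `u`. Both the value of the star clustering and the
optimum are compared with `lam * n` and `S`.

Lower bound. If the leaves of each star weigh at most three times its centre `u`, the star has
weight at most `4 * w u` and quality at least `k u / (2 * w u)`. If moreover `4 * lam * w u ≤ 1` for
every centre with leaves, half of this quality pays `lam` for each leaf, and the value is at least
`lam * n + S / 4` (`le_objective_of_stars`).

Upper bound. An edge is charged to the stars for one of four reasons: one endpoint `u` has large
`lam * w u`; one endpoint is a centre at most twice as heavy as the other; one endpoint hangs on a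
centre no heavier than the other; or one endpoint is a centre whose leaves outnumber half the ratio
of the two weights. Each reason pays 1 for the edge in a form whose sum over all pairs in a cluster
has the factor `w(C)`, so dividing by `w(C)` leaves a sum over vertices. Hence every clustering has
value at most `9 * lam * n + 10 * S` (`objective_le_of_charged`), and the ratio is 40, better than
169.

The greedy rule produces such stars. The vertices are taken in an order of increasing weight, up to
a factor of two. A vertex that already has leaves remains a centre. Any other vertex is attached to
its lightest unprocessed neighbour `u` with `4 * lam * w u ≤ 1` whose load is still below `w u`, or
stays alone if there is none. `GreedyInv.keep` and `GreedyInv.assign` show that every edge at a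
processed vertex gets charged.

Only the order costs more than linear time. For real weights a tournament tree extracts the at most
`2 * m` vertices that have a neighbour. For integer weights the factor of two permits a bucket sort
by digit count and leading digit in base `n + 1`, with `O(n)` buckets for polynomial weights. No
coin is ever flipped, so the expectation is that of a constant. -/

namespace GraphClustering

/-! ### Verification of programs -/

/-- The value of a word expression when no fault occurs. -/
@[simp] def NExp.val (s : State) : NExp → ℕ
  | .lit k => k
  | .reg x => s.nreg x
  | .get a i => s.narr a (i.val s)
  | .add e f => e.val s + f.val s
  | .sub e f => e.val s - f.val s
  | .mul e f => e.val s * f.val s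
  | .div e f => e.val s / f.val s
  | .mod e f => e.val s % f.val s

/-- A sufficient condition for the evaluation of a word expression not to fault. -/
@[simp] def NExp.Safe (W : ℕ) (s : State) : NExp → Prop
  | .lit k => k < W
  | .reg _ => True
  | .get _ i => i.Safe W s
  | .add e f => e.Safe W s ∧ f.Safe W s ∧ e.val s + f.val s < W
  | .sub e f => e.Safe W s ∧ f.Safe W s ∧ e.val s - f.val s < W
  | .mul e f => e.Safe W s ∧ f.Safe W s ∧ e.val s * f.val s < W
  | .div e f => e.Safe W s ∧ f.Safe W s ∧ f.val s ≠ 0 ∧ e.val s / f.val s < W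
  | .mod e f => e.Safe W s ∧ f.Safe W s ∧ f.val s ≠ 0 ∧ e.val s % f.val s < W

/-- The value of a real expression when no fault occurs. -/
@[simp] noncomputable def RExp.val (s : State) : RExp → ℝ
  | .ofWord e => e.val s
  | .reg x => s.rreg x
  | .get a i => s.rarr a (i.val s)
  | .add e f => e.val s + f.val s
  | .sub e f => e.val s - f.val s
  | .mul e f => e.val s * f.val s
  | .div e f => e.val s / f.val s

/-- A sufficient condition for the evaluation of a real expression not to fault. -/
@[simp] def RExp.Safe (W : ℕ) (s : State) : RExp → Prop
  | .ofWord e => e.Safe W s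
  | .reg _ => True
  | .get _ i => i.Safe W s
  | .add e f => e.Safe W s ∧ f.Safe W s
  | .sub e f => e.Safe W s ∧ f.Safe W s
  | .mul e f => e.Safe W s ∧ f.Safe W s
  | .div e f => e.Safe W s ∧ f.Safe W s ∧ f.val s ≠ 0

/-- The truth of a test when no fault occurs. -/
@[simp] def BExp.Holds (s : State) : BExp → Prop
  | .nlt e f => e.val s < f.val s
  | .neq e f => e.val s = f.val s
  | .rlt e f => e.val s < f.val s
  | .not b => ¬ b.Holds s
  | .and b c => b.Holds s ∧ c.Holds s

/-- A sufficient condition for the evaluation of a test not to fault. -/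
@[simp] def BExp.Safe (W : ℕ) (s : State) : BExp → Prop
  | .nlt e f => e.Safe W s ∧ f.Safe W s
  | .neq e f => e.Safe W s ∧ f.Safe W s
  | .rlt e f => e.Safe W s ∧ f.Safe W s
  | .not b => b.Safe W s
  | .and b c => b.Safe W s ∧ c.Safe W s

theorem NExp.eval_of_safe {W : ℕ} {s : State} {e : NExp} (h : e.Safe W s) :
    e.eval W s = some (e.val s) := by
  induction e with
  | lit k => exact if_pos h
  | reg x => rfl
  | get a i ih => simp [NExp.eval, ih h, NExp.val]
  | add e f ihe ihf | sub e f ihe ihf | mul e f ihe ihf =>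
    obtain ⟨he, hf, hb⟩ := h
    simp [NExp.eval, ihe he, ihf hf, fit, NExp.val, hb]
  | div e f ihe ihf | mod e f ihe ihf =>
    obtain ⟨he, hf, h0, hb⟩ := h
    simp [NExp.eval, ihe he, ihf hf, fit, NExp.val, hb, h0]

theorem RExp.eval_of_safe {W : ℕ} {s : State} {e : RExp} (h : e.Safe W s) :
    e.eval W s = some (e.val s) := by
  induction e with
  | ofWord e => simp [RExp.eval, NExp.eval_of_safe (show e.Safe W s from h), RExp.val]
  | reg x => rfl
  | get a i => simp [RExp.eval, NExp.eval_of_safe (show i.Safe W s from h), RExp.val]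
  | add e f ihe ihf | sub e f ihe ihf | mul e f ihe ihf =>
    obtain ⟨he, hf⟩ := h
    simp [RExp.eval, ihe he, ihf hf, RExp.val]
  | div e f ihe ihf =>
    obtain ⟨he, hf, h0⟩ := h
    simp [RExp.eval, ihe he, ihf hf, RExp.val, h0]

open Classical in
theorem BExp.eval_of_safe {W : ℕ} {s : State} {b : BExp} (h : b.Safe W s) :
    b.eval W s = some (decide (b.Holds s)) := by
  induction b with
  | nlt e f | neq e f =>
    simp only [BExp.eval, NExp.eval_of_safe h.1, NExp.eval_of_safe h.2, BExp.Holds,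
      Option.bind_some, Option.map_some]
    congr
  | rlt e f =>
    simp only [BExp.eval, RExp.eval_of_safe h.1, RExp.eval_of_safe h.2, BExp.Holds,
      Option.bind_some, Option.map_some]
    congr
  | not b ih => by_cases hb : b.Holds s <;> simp [BExp.eval, ih h, BExp.Holds, hb]
  | and b c ihb ihc =>
    by_cases hb : b.Holds s <;> by_cases hc : c.Holds s <;>
      simp [BExp.eval, ihb h.1, ihc h.2, BExp.Holds, hb, hc]

/-- The verification condition of a loop-free program that flips no coins. -/
@[simp] def Cmd.vc (W : ℕ) : Cmd → (State → Prop) → State → Prop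
  | .skip, Q, s => Q s
  | .setN x e, Q, s => e.Safe W s ∧ Q (s.putN x (e.val s))
  | .setR x e, Q, s => e.Safe W s ∧ Q (s.putR x (e.val s))
  | .storeN a i e, Q, s => i.Safe W s ∧ e.Safe W s ∧ Q (s.putNArr a (i.val s) (e.val s))
  | .storeR a i e, Q, s => i.Safe W s ∧ e.Safe W s ∧ Q (s.putRArr a (i.val s) (e.val s))
  | .flip _, _, _ => False
  | .seq p q, Q, s => p.vc W (q.vc W Q) s
  | .ite b p q, Q, s => b.Safe W s ∧ (b.Holds s → p.vc W Q s) ∧ (¬ b.Holds s → q.vc W Q s)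
  | .loop _ _, _, _ => False

/-- An upper bound on the running time of a loop-free program. -/
@[simp] def Cmd.bound : Cmd → ℕ
  | .skip => 1
  | .setN _ e => e.cost + 1
  | .setR _ e => e.cost + 1
  | .storeN _ i e => i.cost + e.cost + 1
  | .storeR _ i e => i.cost + e.cost + 1
  | .flip _ => 1
  | .seq p q => p.bound + q.bound
  | .ite b p q => b.cost + 1 + (p.bound + q.bound)
  | .loop _ _ => 0

/-- From the state `s`, the program `p` halts within the time budget `T`, in a state that does not
depend on the coins, and `Q` holds of this state and the remaining budget. -/
def Runs (W : ℕ) (p : Cmd) (s : State) (T : ℕ) (Q : State → ℕ → Prop) : Prop :=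
  ∃ t s', (∀ ω, Exec W ω p s t s') ∧ t ≤ T ∧ Q s' (T - t)

attribute [simp] NExp.cost RExp.cost BExp.cost

variable {W : ℕ}

/-- Induction over the program as for weakest preconditions. Time and final state are chosen before
the coins, which is possible because `vc` rejects `flip`. -/
theorem exec_of_vc {p : Cmd} {Q : State → Prop} {s : State} (h : p.vc W Q s) :
    ∃ t s', (∀ ω, Exec W ω p s t s') ∧ t ≤ p.bound ∧ Q s' := by
  induction p generalizing Q s with
  | skip => exact ⟨_, _, fun ω => .skip s, le_rfl, h⟩
  | setN x e => exact ⟨_, _, fun ω => .setN (NExp.eval_of_safe h.1), le_rfl, h.2⟩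
  | setR x e => exact ⟨_, _, fun ω => .setR (RExp.eval_of_safe h.1), le_rfl, h.2⟩
  | storeN a i e =>
    exact ⟨_, _, fun ω => .storeN (NExp.eval_of_safe h.1) (NExp.eval_of_safe h.2.1), le_rfl, h.2.2⟩
  | storeR a i e =>
    exact ⟨_, _, fun ω => .storeR (NExp.eval_of_safe h.1) (RExp.eval_of_safe h.2.1), le_rfl, h.2.2⟩
  | flip x => exact h.elim
  | seq p q ihp ihq =>
    obtain ⟨t, s', hp, ht, hq⟩ := ihp h
    obtain ⟨t', s'', hq, ht', hQ⟩ := ihq hq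
    exact ⟨_, _, fun ω => .seq (hp ω) (hq ω), Nat.add_le_add ht ht', hQ⟩
  | ite b p q ihp ihq =>
    obtain ⟨hb, hT, hF⟩ := h
    by_cases hv : b.Holds s
    · obtain ⟨t, s', hp, ht, hQ⟩ := ihp (hT hv)
      refine ⟨_, _, fun ω => .iteTrue (by simp [BExp.eval_of_safe hb, hv]) (hp ω), ?_, hQ⟩
      simp only [Cmd.bound]; omega
    · obtain ⟨t, s', hp, ht, hQ⟩ := ihq (hF hv)
      refine ⟨_, _, fun ω => .iteFalse (by simp [BExp.eval_of_safe hb, hv]) (hp ω), ?_, hQ⟩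
      simp only [Cmd.bound]; omega
  | loop b p => exact h.elim

/-- Only an upper bound on the time of a branching block is tracked, so `Q` is required for every
remaining budget compatible with that bound. -/
theorem Runs.of_vc {p : Cmd} {s : State} {T : ℕ} {Q : State → ℕ → Prop}
    (hT : p.bound ≤ T) (h : p.vc W (fun s' => ∀ T', T ≤ T' + p.bound → Q s' T') s) :
    Runs W p s T Q := by
  obtain ⟨t, s', he, ht, hQ⟩ := exec_of_vc h
  exact ⟨t, s', he, ht.trans hT, hQ _ (by omega)⟩

theorem Runs.seq {p q : Cmd} {s : State} {T : ℕ} {Q : State → ℕ → Prop}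
    (h : Runs W p s T fun s' T' => Runs W q s' T' Q) : Runs W (.seq p q) s T Q := by
  obtain ⟨t, s', hp, ht, t', s'', hq, ht', hQ⟩ := h
  exact ⟨_, _, fun ω => .seq (hp ω) (hq ω), by omega, by rwa [Nat.sub_add_eq]⟩

theorem Runs.ite {b : BExp} {p q : Cmd} {s : State} {T : ℕ} {Q : State → ℕ → Prop}
    (hb : b.Safe W s) (hT : b.cost + 1 ≤ T)
    (hp : b.Holds s → Runs W p s (T - (b.cost + 1)) Q)
    (hq : ¬ b.Holds s → Runs W q s (T - (b.cost + 1)) Q) : Runs W (.ite b p q) s T Q := by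
  by_cases hv : b.Holds s
  · obtain ⟨t, s', h, ht, hQ⟩ := hp hv
    exact ⟨_, _, fun ω => .iteTrue (by simp [BExp.eval_of_safe hb, hv]) (h ω), by omega,
      by rwa [Nat.sub_add_eq]⟩
  · obtain ⟨t, s', h, ht, hQ⟩ := hq hv
    exact ⟨_, _, fun ω => .iteFalse (by simp [BExp.eval_of_safe hb, hv]) (h ω), by omega,
      by rwa [Nat.sub_add_eq]⟩

/-- The budget serves as the loop variant: every test costs at least one step, so strong induction
on `T` gives termination and the time bound together. -/
theorem Runs.loop {b : BExp} {p : Cmd} {Q : State → ℕ → Prop} (I : State → ℕ → Prop)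
    (hI : ∀ s T, I s T → b.Safe W s ∧ b.cost + 1 ≤ T ∧
      (b.Holds s → Runs W p s (T - (b.cost + 1)) I) ∧
      (¬ b.Holds s → Q s (T - (b.cost + 1)))) {s : State} {T : ℕ} (h : I s T) :
    Runs W (.loop b p) s T Q := by
  induction T using Nat.strong_induction_on generalizing s with
  | _ T ih =>
    obtain ⟨hb, hT, hp, hq⟩ := hI s T h
    by_cases hv : b.Holds s
    · obtain ⟨t, s', he, ht, hs'⟩ := hp hv
      obtain ⟨t', s'', he', ht', hQ⟩ := ih _ (by omega) hs'
      refine ⟨_, _, fun ω => .loopStep (by simp [BExp.eval_of_safe hb, hv]) (he ω) (he' ω), by omega, ?_⟩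
      rwa [Nat.sub_add_eq, Nat.sub_add_eq]
    · exact ⟨_, _, fun ω => .loopDone (by simp [BExp.eval_of_safe hb, hv]), hT, hq hv⟩

/-! ### Reading the memory after a write -/

section Memory

variable (s : State) (x y a b i k : ℕ) (r : ℝ)

@[simp] theorem State.nreg_putN : (s.putN x k).nreg y = if y = x then k else s.nreg y := by
  simp [State.putN, Function.update_apply]
@[simp] theorem State.narr_putN : (s.putN x k).narr = s.narr := rfl
@[simp] theorem State.rreg_putN : (s.putN x k).rreg = s.rreg := rfl
@[simp] theorem State.rarr_putN : (s.putN x k).rarr = s.rarr := rfl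
@[simp] theorem State.nreg_putNArr : (s.putNArr a i k).nreg = s.nreg := rfl
@[simp] theorem State.narr_putNArr : (s.putNArr a i k).narr b =
    if b = a then Function.update (s.narr a) i k else s.narr b := by
  simp only [State.putNArr, Function.update_apply]
@[simp] theorem State.rreg_putNArr : (s.putNArr a i k).rreg = s.rreg := rfl
@[simp] theorem State.rarr_putNArr : (s.putNArr a i k).rarr = s.rarr := rfl
@[simp] theorem State.nreg_putRArr : (s.putRArr a i r).nreg = s.nreg := rfl
@[simp] theorem State.narr_putRArr : (s.putRArr a i r).narr = s.narr := rfl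
@[simp] theorem State.rreg_putRArr : (s.putRArr a i r).rreg = s.rreg := rfl
@[simp] theorem State.rarr_putRArr : (s.putRArr a i r).rarr b =
    if b = a then Function.update (s.rarr a) i r else s.rarr b := by
  simp only [State.putRArr, Function.update_apply]

end Memory

/-- Sequential composition of a list of programs. -/
@[simp] def block : List Cmd → Cmd
  | [] => .skip
  | [p] => p
  | p :: q :: l => .seq p (block (q :: l))

/-! ### Star systems: comparing the star clustering with the optimum -/

section Stars

variable {V : Type*} [Fintype V] [DecidableEq V]

/-- The vertices other than `u` that are attached to `u` by `f`. -/
def leaves (f : V → V) (u : V) : Finset V := Finset.univ.filter fun v => f v = u ∧ v ≠ u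

/-- The edge from `v` to `u` is paid for by the stars of `f`. -/
def Charged (w : V → ℝ) (lam : ℝ) (f : V → V) (v u : V) : Prop :=
  1 < 4 * lam * w u ∨ ((leaves f v).Nonempty ∧ w v ≤ 2 * w u) ∨
    (f v ≠ v ∧ w (f v) ≤ w u) ∨ w u ≤ 2 * (leaves f u).card * w v

/-- Handshake lemma for the graph induced on `C`: each edge gives two ordered pairs, and each of
these is paid by `φ a b + φ b a`. Thus a payment from either orientation suffices. -/
theorem two_mul_card_innerEdges_le (G : SimpleGraph V) (C : Finset V) (φ : V → V → ℝ)
    (h0 : ∀ a b, 0 ≤ φ a b) (h1 : ∀ a b, G.Adj a b → 1 ≤ φ a b + φ b a) :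
    2 * ((innerEdges G C).card : ℝ) ≤ 2 * ∑ a ∈ C, ∑ b ∈ C, φ a b := by
  classical
  let H : SimpleGraph V :=
    { Adj := fun a b => G.Adj a b ∧ a ∈ C ∧ b ∈ C
      symm := ⟨fun a b h => ⟨h.1.symm, h.2.2, h.2.1⟩⟩
      loopless := ⟨fun a h => G.irrefl h.1⟩ }
  have hE : innerEdges G C = H.edgeFinset := by
    ext e
    induction e with
    | _ a b => simp [innerEdges, H]
  have hdeg : 2 * ((innerEdges G C).card : ℝ) = ∑ a, ∑ b, if H.Adj a b then (1 : ℝ) else 0 := by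
    have := H.sum_degrees_eq_twice_card_edges
    rw [hE]
    rw [← Nat.cast_two, ← Nat.cast_mul, ← this, Nat.cast_sum]
    refine Finset.sum_congr rfl fun a _ => ?_
    rw [← H.card_neighborFinset_eq_degree, H.neighborFinset_eq_filter]
    rw [Finset.sum_boole]
  have hle : ∑ a, ∑ b, (if H.Adj a b then (1 : ℝ) else 0)
      ≤ ∑ a ∈ C, ∑ b ∈ C, (φ a b + φ b a) := by
    have hC : ∑ a, ∑ b, (if H.Adj a b then (1 : ℝ) else 0)
        = ∑ a ∈ C, ∑ b ∈ C, (if H.Adj a b then (1 : ℝ) else 0) := by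
      rw [← Finset.sum_subset (Finset.subset_univ C)]
      · refine Finset.sum_congr rfl fun a _ => ?_
        rw [← Finset.sum_subset (Finset.subset_univ C)]
        intro b _ hb
        exact if_neg fun h => hb h.2.2
      · intro a _ ha
        exact Finset.sum_eq_zero fun b _ => if_neg fun h => ha h.2.1
    rw [hC]
    refine Finset.sum_le_sum fun a _ => Finset.sum_le_sum fun b _ => ?_
    split_ifs with h
    · exact h1 a b h.1
    · exact add_nonneg (h0 _ _) (h0 _ _)
  rw [hdeg]
  refine hle.trans (le_of_eq ?_)
  simp_rw [Finset.sum_add_distrib]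
  rw [Finset.sum_comm (f := fun a b => φ b a), two_mul]

/-- Double counting along the fibres of `f`: each attached vertex is counted once, at its centre. -/
theorem sum_leaves (f : V → V) (g : V → ℝ) :
    ∑ u, ((leaves f u).card : ℝ) * g u = ∑ v, if f v ≠ v then g (f v) else 0 := by
  have h1 : ∀ u, ((leaves f u).card : ℝ) * g u
      = ∑ v with f v = u, if f v ≠ v then g (f v) else 0 := by
    intro u
    rw [← nsmul_eq_mul, ← Finset.sum_const, leaves, ← Finset.filter_filter, Finset.sum_filter]
    refine Finset.sum_congr rfl fun v hv => ?_
    obtain rfl := (Finset.mem_filter.1 hv).2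
    simp [eq_comm]
  simp_rw [h1]
  exact Finset.sum_fiberwise _ f _

theorem sum_parts_sum (P : Clustering V) (g : V → ℝ) :
    ∑ C ∈ P.parts, ∑ v ∈ C, g v = ∑ v, g v := by
  have h := Finset.sum_biUnion (s := P.parts) (t := id) (f := g) P.disjoint
  rw [P.biUnion_parts] at h
  exact h.symm

variable {G : SimpleGraph V} {w : V → ℝ} {lam : ℝ} {f : V → V}

/-- Payments of the form `w u * y v` and `w u * w v * z u` both produce the factor `w(C)` when
summed over all pairs in `C`, and it cancels the denominator of the quality. -/
theorem quality_le_of_charged (hw : ∀ v, 0 < w v) (hlam : 0 ≤ lam)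
    (hf : ∀ a b, G.Adj a b → Charged w lam f a b ∨ Charged w lam f b a) (C : Finset V)
    (hC : C.Nonempty) :
    quality G w C ≤ ∑ v ∈ C, (8 * lam + 8 * ((leaves f v).card * (w v)⁻¹)
      + 2 * if f v ≠ v then (w (f v))⁻¹ else 0) := by
  -- The three terms of `y` pay for the first three kinds of charge, at a rate per unit weight of
  -- the other endpoint. The fourth kind is paid by `z`, at a rate per product of the weights.
  set y : V → ℝ := fun v => 4 * lam + 2 * ((leaves f v).card * (w v)⁻¹)
      + if f v ≠ v then (w (f v))⁻¹ else 0 with hy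
  set z : V → ℝ := fun u => 2 * (leaves f u).card * ((w u)⁻¹ * (w u)⁻¹) with hz
  have hi : ∀ v, 0 < (w v)⁻¹ := fun v => inv_pos.2 (hw v)
  have hy0 : ∀ v, 0 ≤ y v := by
    intro v
    have := hi v
    have := hi (f v)
    simp only [hy]
    split_ifs <;> positivity
  have hz0 : ∀ v, 0 ≤ z v := by
    intro v
    have := hi v
    simp only [hz]
    positivity
  have hpay : ∀ v u, Charged w lam f v u → 1 ≤ w u * y v + w u * w v * z u := by
    intro v u h
    have hu := hw u
    have hv := hw v
    have hleaf : 0 ≤ if f v ≠ v then (w (f v))⁻¹ else 0 := by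
      split_ifs
      · exact (hi _).le
      · exact le_rfl
    have hk : 0 ≤ ((leaves f v).card : ℝ) * (w v)⁻¹ := mul_nonneg (Nat.cast_nonneg _) (hi v).le
    rcases h with h | ⟨h, h'⟩ | ⟨h, h'⟩ | h
    · have h2 : 4 * lam ≤ y v := by simp only [hy]; linarith
      nlinarith [mul_le_mul_of_nonneg_left h2 hu.le, mul_nonneg (mul_pos hu hv).le (hz0 u)]
    · have h2 : 2 * (w v)⁻¹ ≤ y v := by
        have hc : (1 : ℝ) ≤ (leaves f v).card := by exact_mod_cast h.card_pos
        have := mul_le_mul_of_nonneg_right hc (hi v).le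
        simp only [hy]; linarith
      have h3 : 1 ≤ w u * (2 * (w v)⁻¹) := by
        rw [← mul_assoc, ← div_eq_mul_inv, le_div_iff₀ hv]; linarith
      nlinarith [mul_le_mul_of_nonneg_left h2 hu.le, mul_nonneg (mul_pos hu hv).le (hz0 u)]
    · have h2 : (w (f v))⁻¹ ≤ y v := by
        simp only [hy, if_pos h]; linarith
      have h3 : 1 ≤ w u * (w (f v))⁻¹ := by
        rw [← div_eq_mul_inv, le_div_iff₀ (hw _)]; linarith
      nlinarith [mul_le_mul_of_nonneg_left h2 hu.le, mul_nonneg (mul_pos hu hv).le (hz0 u)]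
    · have h3 : w u * w v * z u = 2 * (leaves f u).card * w v / w u := by
        simp only [hz]; field_simp
      have h4 : 1 ≤ 2 * (leaves f u).card * w v / w u := by
        rw [le_div_iff₀ hu]; linarith
      nlinarith [mul_nonneg hu.le (hy0 v)]
  have h0 : ∀ a b, 0 ≤ w b * y a + w b * w a * z b := fun a b =>
    add_nonneg (mul_nonneg (hw b).le (hy0 a)) (mul_nonneg (mul_pos (hw b) (hw a)).le (hz0 b))
  have hmain := two_mul_card_innerEdges_le G C (fun v u => w u * y v + w u * w v * z u) h0
    (fun a b hab => by
      rcases hf a b hab with h | h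
      · linarith [hpay a b h, h0 b a]
      · linarith [hpay b a h, h0 a b])
  have hwC : 0 < ∑ v ∈ C, w v := Finset.sum_pos (fun v _ => hw v) hC
  rw [quality, div_le_iff₀ hwC]
  refine hmain.trans (le_of_eq ?_)
  have e1 : ∑ a ∈ C, ∑ b ∈ C, (w b * y a + w b * w a * z b)
      = (∑ a ∈ C, (y a + w a * z a)) * ∑ v ∈ C, w v := by
    simp_rw [Finset.sum_add_distrib]
    rw [add_mul, Finset.sum_mul_sum, Finset.sum_mul_sum]
    congr 1
    · exact Finset.sum_congr rfl fun a _ => Finset.sum_congr rfl fun b _ => mul_comm _ _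
    · rw [Finset.sum_comm]
      exact Finset.sum_congr rfl fun a _ => Finset.sum_congr rfl fun b _ => by ring
  rw [e1, ← mul_assoc]
  congr 1
  rw [Finset.mul_sum]
  refine Finset.sum_congr rfl fun v _ => ?_
  have := (hw v).ne'
  simp only [hy, hz]
  field_simp
  ring

/-- There are at most `n` clusters, which raises `8 * lam` to `9 * lam` per vertex. By `sum_leaves`,
the terms at attached vertices add 2 to the coefficient 8 of the leaf sum. -/
theorem objective_le_of_charged (hw : ∀ v, 0 < w v) (hlam : 0 ≤ lam)
    (hf : ∀ a b, G.Adj a b → Charged w lam f a b ∨ Charged w lam f b a) (P : Clustering V) :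
    objective G w lam P
      ≤ 9 * (lam * Fintype.card V) + 10 * ∑ u, (leaves f u).card * (w u)⁻¹ := by
  have h1 : objective G w lam P ≤ ∑ C ∈ P.parts, ∑ v ∈ C, (9 * lam
      + 8 * ((leaves f v).card * (w v)⁻¹) + 2 * if f v ≠ v then (w (f v))⁻¹ else 0) := by
    refine Finset.sum_le_sum fun C hC => ?_
    have hne := P.nonempty_of_mem_parts hC
    have hq := quality_le_of_charged hw hlam hf C hne
    have hl : lam ≤ ∑ v ∈ C, lam := by
      rw [Finset.sum_const, nsmul_eq_mul]
      have : (1 : ℝ) ≤ C.card := by exact_mod_cast hne.card_pos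
      nlinarith
    calc _ ≤ _ := add_le_add hl hq
      _ = _ := by
        rw [← Finset.sum_add_distrib]
        exact Finset.sum_congr rfl fun v _ => by ring
  refine h1.trans (le_of_eq ?_)
  rw [sum_parts_sum P, Finset.sum_add_distrib, Finset.sum_add_distrib, ← Finset.mul_sum,
    ← Finset.mul_sum, ← Finset.mul_sum, ← sum_leaves f fun u => (w u)⁻¹]
  simp
  ring

/-- Each cluster is one star. With centre `u` its quality is at least `k / (2 * w u)`; one half of
this is kept, and the other half covers `k * lam` because `lam ≤ 1 / (4 * w u)` whenever `u` has a
leaf. -/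
theorem le_objective_of_stars (hw : ∀ v, 0 < w v) (hff : ∀ v, f (f v) = f v)
    (hadj : ∀ v, f v ≠ v → G.Adj v (f v) ∧ 4 * lam * w (f v) ≤ 1)
    (hload : ∀ u, ∑ v ∈ leaves f u, w v ≤ 3 * w u) (P : Clustering V)
    (hP : ∀ u v, f u = f v ↔ ∃ C ∈ P.parts, u ∈ C ∧ v ∈ C) :
    lam * Fintype.card V + 4⁻¹ * ∑ u, (leaves f u).card * (w u)⁻¹ ≤ objective G w lam P := by
  have h1 : lam * Fintype.card V + 4⁻¹ * ∑ u, (leaves f u).card * (w u)⁻¹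
      = ∑ C ∈ P.parts, ∑ v ∈ C, (lam + 4⁻¹ * ((leaves f v).card * (w v)⁻¹)) := by
    rw [sum_parts_sum P, Finset.sum_add_distrib, ← Finset.mul_sum]
    simp
    ring
  rw [h1]
  refine Finset.sum_le_sum fun C hC => ?_
  obtain ⟨v₀, hv₀⟩ := P.nonempty_of_mem_parts hC
  set u := f v₀ with hu
  have hmem : ∀ v, v ∈ C ↔ f v = u := by
    intro v
    rw [hu, hP]
    constructor
    · intro hv; exact ⟨C, hC, hv, hv₀⟩
    · rintro ⟨D, hD, hv, hD₀⟩
      rwa [P.disjoint.elim hC hD (Finset.not_disjoint_iff.2 ⟨v₀, hv₀, hD₀⟩)]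
  have hfu : f u = u := hff v₀
  have hCu : C = insert u (leaves f u) := by
    ext v
    rw [hmem, Finset.mem_insert, leaves, Finset.mem_filter]
    constructor
    · intro h
      by_cases hvu : v = u
      · exact .inl hvu
      · exact .inr ⟨Finset.mem_univ _, h, hvu⟩
    · rintro (rfl | h)
      · exact hfu
      · exact h.2.1
  have hnot : u ∉ leaves f u := by simp [leaves]
  -- Idempotence forbids chains of two attachments, so only the centre contributes to the leaf sum
  -- of its cluster.
  have hzero : ∀ v ∈ leaves f u, leaves f v = ∅ := by
    intro v hv
    obtain ⟨-, hv, hne⟩ := Finset.mem_filter.1 hv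
    refine Finset.eq_empty_of_forall_notMem fun x hx => ?_
    obtain ⟨-, hx, -⟩ := Finset.mem_filter.1 hx
    have := hff x
    rw [hx, hv] at this
    exact hne this.symm
  have hsum : ∑ v ∈ C, (lam + 4⁻¹ * ((leaves f v).card * (w v)⁻¹))
      = lam + 4⁻¹ * ((leaves f u).card * (w u)⁻¹) + (leaves f u).card * lam := by
    rw [hCu, Finset.sum_insert hnot]
    congr 1
    rw [← nsmul_eq_mul, ← Finset.sum_const]
    exact Finset.sum_congr rfl fun v hv => by simp [hzero v hv]
  have hedges : (leaves f u).card ≤ (innerEdges G C).card := by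
    refine Finset.card_le_card_of_injOn (fun v => s(v, u)) ?_ ?_
    · intro v hv
      obtain ⟨-, hv1, hv2⟩ := Finset.mem_filter.1 (Finset.mem_coe.1 hv)
      have hA := (hadj v (by rw [hv1]; exact hv2.symm)).1
      rw [hv1] at hA
      simp [innerEdges, hA, hmem, hv1, hfu]
    · intro a ha b hb hab
      have := (Finset.mem_filter.1 (Finset.mem_coe.1 ha)).2.2
      simp only [Sym2.eq_iff] at hab
      rcases hab with h | h
      · exact h.1
      · exact (this h.1).elim
  have hwC : ∑ v ∈ C, w v ≤ 4 * w u := by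
    rw [hCu, Finset.sum_insert hnot]
    linarith [hload u]
  have hwC0 : 0 < ∑ v ∈ C, w v := Finset.sum_pos (fun v _ => hw v) ⟨v₀, hv₀⟩
  have hq : 2⁻¹ * ((leaves f u).card * (w u)⁻¹) ≤ quality G w C := by
    rw [quality, le_div_iff₀ hwC0]
    have hk : ((leaves f u).card : ℝ) ≤ (innerEdges G C).card := by exact_mod_cast hedges
    have hi := inv_pos.2 (hw u)
    calc 2⁻¹ * ((leaves f u).card * (w u)⁻¹) * ∑ v ∈ C, w v
        ≤ 2⁻¹ * ((leaves f u).card * (w u)⁻¹) * (4 * w u) := by gcongr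
      _ = 2 * (leaves f u).card := by have := (hw u).ne'; field_simp; ring
      _ ≤ _ := by linarith
  have hl : ((leaves f u).card : ℝ) * lam ≤ 4⁻¹ * ((leaves f u).card * (w u)⁻¹) := by
    rcases (leaves f u).eq_empty_or_nonempty with h | ⟨v, hv⟩
    · simp [h]
    · obtain ⟨-, hv1, hv2⟩ := Finset.mem_filter.1 hv
      have hA := (hadj v (by rw [hv1]; exact hv2.symm)).2
      rw [hv1] at hA
      have : lam ≤ 4⁻¹ * (w u)⁻¹ := by
        rw [← mul_inv, ← one_div, le_div_iff₀ (by have := hw u; positivity)]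
        linarith
      calc _ ≤ ((leaves f u).card : ℝ) * (4⁻¹ * (w u)⁻¹) := by gcongr
        _ = _ := by ring
  rw [hsum]
  linarith

theorem objective_le_mul_objective (hw : ∀ v, 0 < w v) (hlam : 0 ≤ lam)
    (hff : ∀ v, f (f v) = f v)
    (hadj : ∀ v, f v ≠ v → G.Adj v (f v) ∧ 4 * lam * w (f v) ≤ 1)
    (hload : ∀ u, ∑ v ∈ leaves f u, w v ≤ 3 * w u)
    (hf : ∀ a b, G.Adj a b → Charged w lam f a b ∨ Charged w lam f b a) (P P' : Clustering V)
    (hP : ∀ u v, f u = f v ↔ ∃ C ∈ P.parts, u ∈ C ∧ v ∈ C) :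
    objective G w lam P' ≤ 40 * objective G w lam P := by
  have h1 := objective_le_of_charged hw hlam hf P'
  have h2 := le_objective_of_stars hw hff hadj hload P hP
  have h3 : 0 ≤ lam * Fintype.card V := by positivity
  linarith

/-- The partition into the fibres of `f`. -/
theorem exists_clustering (f : V → V) :
    ∃ P : Clustering V, ∀ u v, f u = f v ↔ ∃ C ∈ P.parts, u ∈ C ∧ v ∈ C := by
  classical
  refine ⟨Finpartition.ofSetoid (Setoid.ker f), fun u v => ?_⟩
  rw [← Setoid.ker_def]
  constructor
  · intro h
    exact ⟨_, (Finpartition.ofSetoid (Setoid.ker f)).part_mem.2 (Finset.mem_univ u),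
      Finpartition.mem_part_ofSetoid_iff_rel.2 ((Setoid.ker f).refl _),
      Finpartition.mem_part_ofSetoid_iff_rel.2 h⟩
  · rintro ⟨C, hC, hu, hv⟩
    rw [← Finpartition.part_eq_of_mem _ hC hu] at hv
    exact Finpartition.mem_part_ofSetoid_iff_rel.1 hv

theorem exists_isOptimal (G : SimpleGraph V) (w : V → ℝ) (lam : ℝ) :
    ∃ P : Clustering V, IsOptimal G w lam P := by
  classical
  obtain ⟨P, hP⟩ := Finite.exists_max (objective G w lam)
  exact ⟨P, hP⟩

end Stars

/-! ### The greedy invariant: every edge at a processed vertex is charged -/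

section Greedy

variable {V : Type*} [Fintype V] [DecidableEq V]

/-- The vertices in `D` have been processed, and `f` is the current system of stars. -/
structure GreedyInv (G : SimpleGraph V) (w : V → ℝ) (lam : ℝ) (f : V → V) (D : Set V) : Prop where
  idem : ∀ v, f (f v) = f v
  attached : ∀ v, f v ≠ v → v ∈ D ∧ G.Adj v (f v) ∧ 4 * lam * w (f v) ≤ 1
  load : ∀ u, ∑ v ∈ leaves f u, w v ≤ 3 * w u
  charged : ∀ a ∈ D, ∀ b, G.Adj a b → Charged w lam f a b ∨ Charged w lam f b a

/-- The vertex `u` may receive another leaf, when the vertices of `D` have been processed. -/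
def Eligible (w : V → ℝ) (lam : ℝ) (f : V → V) (D : Set V) (u : V) : Prop :=
  u ∉ D ∧ ∑ x ∈ leaves f u, w x < w u ∧ 4 * lam * w u ≤ 1

variable {G : SimpleGraph V} {w : V → ℝ} {lam : ℝ} {f : V → V} {D : Set V} {v b : V}

theorem mem_leaves {u : V} : v ∈ leaves f u ↔ f v = u ∧ v ≠ u := by simp [leaves]

theorem GreedyInv.id (hw : ∀ v, 0 < w v) : GreedyInv G w lam id ∅ where
  idem _ := rfl
  attached v h := (h rfl).elim
  load u := by
    have : leaves (V := V) _root_.id u = ∅ :=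
      Finset.eq_empty_of_forall_notMem fun v hv => (mem_leaves.1 hv).2 (mem_leaves.1 hv).1
    rw [this, Finset.sum_empty]
    linarith [hw u]
  charged a h := h.elim

theorem GreedyInv.apply_eq (h : GreedyInv G w lam f D) (hv : v ∉ D) : f v = v :=
  by_contra fun hne => hv (h.attached v hne).1

theorem GreedyInv.leaves_subset (h : GreedyInv G w lam f D) (u : V) : ∀ x ∈ leaves f u, x ∈ D := by
  intro x hx
  obtain ⟨rfl, hne⟩ := mem_leaves.1 hx
  exact (h.attached x hne.symm).1

/-- Edges from `v` back into `D` were charged when their other end was processed, so only edges to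
unprocessed vertices need a reason. -/
theorem GreedyInv.keep (h : GreedyInv G w lam f D)
    (hc : ∀ u, G.Adj v u → u ∉ insert v D → Charged w lam f v u) :
    GreedyInv G w lam f (insert v D) where
  idem := h.idem
  attached x hx := ⟨.inr (h.attached x hx).1, (h.attached x hx).2⟩
  load := h.load
  charged := by
    rintro a (rfl | ha) b hab
    · by_cases hb : b ∈ D
      · exact (h.charged b hb a hab.symm).symm
      · exact .inl (hc b hab (by simp [hab.ne', hb]))
    · exact h.charged a ha b hab

/-- An unprocessed vertex is refused either because `lam * w u` is large, or because its load has
reached `w u`. In the second case each leaf was processed earlier and weighs at most `2 * w v`, so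
`w u ≤ 2 * k * w v`. -/
theorem GreedyInv.charged_of_not_eligible (h : GreedyInv G w lam f D)
    (hD : ∀ a ∈ D, w a ≤ 2 * w v) {u : V} (hu : u ∉ insert v D)
    (he : ¬ Eligible w lam f (insert v D) u) : Charged w lam f v u := by
  by_cases hl : 4 * lam * w u ≤ 1
  · have hle : w u ≤ ∑ x ∈ leaves f u, w x := not_lt.1 fun hlt => he ⟨hu, hlt, hl⟩
    refine .inr (.inr (.inr (hle.trans ?_)))
    calc ∑ x ∈ leaves f u, w x ≤ ∑ x ∈ leaves f u, 2 * w v :=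
          Finset.sum_le_sum fun x hx => hD x (h.leaves_subset u x hx)
      _ = _ := by rw [Finset.sum_const, nsmul_eq_mul]; ring
  · exact .inl (not_le.1 hl)

theorem leaves_update (hv : f v = v) (u : V) :
    leaves (Function.update f v b) u = if u = b ∧ b ≠ v then insert v (leaves f u) else
      leaves f u := by
  ext x
  by_cases hx : x = v
  · subst hx
    split_ifs with h
    · obtain ⟨rfl, h⟩ := h
      simp [mem_leaves, h.symm]
    · simp only [mem_leaves, Function.update_self, hv]
      constructor
      · rintro ⟨rfl, h2⟩
        exact (h ⟨rfl, h2.symm⟩).elim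
      · rintro ⟨h1, h2⟩
        exact (h2 h1).elim
  · split_ifs with h <;> simp [mem_leaves, hx]

/-- Eligible neighbours of `v` are charged because `b` is the lightest of them; the others by
`charged_of_not_eligible`. The load stays below `w b + w v ≤ 3 * w b`. Idempotence survives since
`v` has no leaves and `b`, being unprocessed, is its own centre. -/
theorem GreedyInv.assign (h : GreedyInv G w lam f D) (hw : ∀ v, 0 < w v) (hv : v ∉ D)
    (hleaf : leaves f v = ∅)
    (hvb : G.Adj v b) (hb : Eligible w lam f (insert v D) b) (hwb : w v ≤ 2 * w b)
    (hD : ∀ a ∈ D, w a ≤ 2 * w v)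
    (hmin : ∀ u, G.Adj v u → Eligible w lam f (insert v D) u → w b ≤ w u) :
    GreedyInv G w lam (Function.update f v b) (insert v D) := by
  have hfv := h.apply_eq hv
  have hbv : b ≠ v := hvb.ne'
  have hbD : b ∉ D := fun hh => hb.1 (.inr hh)
  have hfb := h.apply_eq hbD
  have hl := leaves_update (b := b) hfv
  have hsub : ∀ u, leaves f u ⊆ leaves (Function.update f v b) u := by
    intro u
    rw [hl u]
    split_ifs
    · exact Finset.subset_insert _ _
    · exact subset_rfl
  -- Charges persist: leaf sets only grow, and the one changed value is at `v`, which was not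
  -- attached before.
  have hmono : ∀ x y, Charged w lam f x y → Charged w lam (Function.update f v b) x y := by
    rintro x y (hc | hc | hc | hc)
    · exact .inl hc
    · exact .inr (.inl ⟨hc.1.mono (hsub x), hc.2⟩)
    · have hx : x ≠ v := by rintro rfl; exact hc.1 hfv
      refine .inr (.inr (.inl ?_))
      rwa [Function.update_of_ne hx]
    · refine .inr (.inr (.inr (hc.trans ?_)))
      have h1 : ((leaves f y).card : ℝ) ≤ (leaves (Function.update f v b) y).card := by
        exact_mod_cast Finset.card_le_card (hsub y)
      have := hw x
      gcongr
  refine ⟨?_, ?_, ?_, ?_⟩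
  · intro x
    by_cases hx : x = v
    · subst hx
      rw [Function.update_self, Function.update_of_ne hbv, hfb]
    · rw [Function.update_of_ne hx]
      by_cases hfx : f x = v
      · have : x ∈ leaves f v := mem_leaves.2 ⟨hfx, hx⟩
        simp [hleaf] at this
      · rw [Function.update_of_ne hfx, h.idem]
  · intro x hx
    by_cases hxv : x = v
    · subst hxv
      rw [Function.update_self]
      exact ⟨.inl rfl, hvb, hb.2.2⟩
    · rw [Function.update_of_ne hxv] at hx ⊢
      exact ⟨.inr (h.attached x hx).1, (h.attached x hx).2⟩
  · intro u
    rw [hl u]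
    split_ifs with hu
    · rw [hu.1, Finset.sum_insert (by simp [mem_leaves, hfv])]
      linarith [hb.2.1]
    · exact h.load u
  · rintro x (rfl | hx) u hxu
    · by_cases hu : u ∈ D
      · exact (h.charged u hu x hxu.symm).symm.imp (hmono _ _) (hmono _ _)
      · left
        have hu' : u ∉ insert x D := by simp [hxu.ne', hu]
        by_cases he : Eligible w lam f (insert x D) u
        · refine .inr (.inr (.inl ?_))
          rw [Function.update_self]
          exact ⟨hbv, hmin u hxu he⟩
        · exact hmono _ _ (h.charged_of_not_eligible hD hu' he)
    · exact (h.charged x hx u hxu).imp (hmono _ _) (hmono _ _)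

end Greedy

/-! ### Linked lists -/

/-- Following `nxt` from `p` runs through the cells of `l` and ends at the null cell `0`. -/
def Chain (nxt : ℕ → ℕ) : ℕ → List ℕ → Prop
  | p, [] => p = 0
  | p, q :: l => p = q ∧ q ≠ 0 ∧ Chain nxt (nxt q) l

theorem Chain.update {nxt : ℕ → ℕ} {p q r : ℕ} {l : List ℕ} (h : Chain nxt p l) (hq : q ∉ l) :
    Chain (Function.update nxt q r) p l := by
  induction l generalizing p with
  | nil => exact h
  | cons a l ih =>
    obtain ⟨h1, h2, h3⟩ := h
    rw [List.mem_cons, not_or] at hq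
    refine ⟨h1, h2, ?_⟩
    rw [Function.update_of_ne (Ne.symm hq.1)]
    exact ih h3 hq.2

theorem Chain.eq_nil_iff {nxt : ℕ → ℕ} {p : ℕ} {l : List ℕ} (h : Chain nxt p l) :
    p = 0 ↔ l = [] := by
  cases l with
  | nil => exact iff_of_true h rfl
  | cons a l => simp [h.1, h.2.1]

theorem Chain.exists_cons {nxt : ℕ → ℕ} {p : ℕ} {l : List ℕ} (h : Chain nxt p l) (hp : p ≠ 0) :
    ∃ l', l = p :: l' ∧ Chain nxt (nxt p) l' := by
  cases l with
  | nil => exact (hp h).elim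
  | cons a l =>
    obtain ⟨rfl, -, h⟩ := h
    exact ⟨l, rfl, h⟩

/-- The linked list with head `head b` consists of the cells `L b`. -/
def Buckets (head nxt : ℕ → ℕ) (L : ℕ → List ℕ) : Prop := ∀ b, Chain nxt (head b) (L b)

/-- Insertion at the front. Since `q` is fresh in every list, overwriting its successor disturbs
none of them. -/
theorem Buckets.push {head nxt : ℕ → ℕ} {L : ℕ → List ℕ} (h : Buckets head nxt L) {q : ℕ}
    (b : ℕ) (hq0 : q ≠ 0) (hq : ∀ b, q ∉ L b) :
    Buckets (Function.update head b q) (Function.update nxt q (head b))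
      (Function.update L b (q :: L b)) := by
  intro c
  by_cases hc : c = b
  · subst hc
    rw [Function.update_self, Function.update_self]
    refine ⟨rfl, hq0, ?_⟩
    rw [Function.update_self]
    exact (h c).update (hq c)
  · rw [Function.update_of_ne hc, Function.update_of_ne hc]
    exact (h c).update (hq c)

theorem mem_update_cons {L : ℕ → List ℕ} {b q v x : ℕ} :
    x ∈ Function.update L b (q :: L b) v ↔ (x = q ∧ v = b) ∨ x ∈ L v := by
  by_cases hv : v = b
  · subst hv; simp
  · simp [hv]

theorem sum_length_update_cons {L : ℕ → List ℕ} {b q n : ℕ} (hb : b < n) :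
    ∑ v ∈ Finset.range n, (Function.update L b (q :: L b) v).length
      = ∑ v ∈ Finset.range n, (L v).length + 1 := by
  have hb' : b ∈ Finset.range n := Finset.mem_range.2 hb
  rw [← Finset.add_sum_erase _ _ hb', ← Finset.add_sum_erase _ (fun v => (L v).length) hb',
    Function.update_self, List.length_cons]
  have : ∑ v ∈ (Finset.range n).erase b, (Function.update L b (q :: L b) v).length
      = ∑ v ∈ (Finset.range n).erase b, (L v).length :=
    Finset.sum_congr rfl fun v hv => by rw [Function.update_of_ne (Finset.ne_of_mem_erase hv)]
  omega

/-! ### The adjacency lists -/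

/-- The first `e` edges `{a i, b i}` have been entered into the adjacency lists: edge `i` occupies
the cells `2 i + 1` (in the list of `a i`) and `2 i + 2` (in the list of `b i`), and `dst` holds
the other endpoint. -/
structure EdgeLists (n : ℕ) (a b : ℕ → ℕ) (e : ℕ) (head nxt dst : ℕ → ℕ) (L : ℕ → List ℕ) :
    Prop where
  buckets : Buckets head nxt L
  mem : ∀ v q, q ∈ L v ↔ ∃ i < e, (q = 2 * i + 1 ∧ a i = v) ∨ (q = 2 * i + 2 ∧ b i = v)
  dst : ∀ i < e, dst (2 * i + 1) = b i ∧ dst (2 * i + 2) = a i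
  size : ∑ v ∈ Finset.range n, (L v).length = 2 * e

/-- Two front insertions. All cells in use are at most `2 * e`, so `2 * e + 1` and `2 * e + 2` are
fresh; numbering from 1 leaves 0 free as the null cell. -/
theorem EdgeLists.push {n : ℕ} {a b : ℕ → ℕ} {e : ℕ} {head nxt dst : ℕ → ℕ} {L : ℕ → List ℕ}
    (h : EdgeLists n a b e head nxt dst L) (ha : a e < n) (hb : b e < n) :
    ∃ L', EdgeLists n a b (e + 1)
      (Function.update (Function.update head (a e) (2 * e + 1)) (b e) (2 * e + 2))
      (Function.update (Function.update nxt (2 * e + 1) (head (a e))) (2 * e + 2)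
        (Function.update head (a e) (2 * e + 1) (b e)))
      (Function.update (Function.update dst (2 * e + 1) (b e)) (2 * e + 2) (a e)) L' := by
  have hlt : ∀ v q, q ∈ L v → q < 2 * e + 1 := by
    intro v q hq
    obtain ⟨i, hi, h | h⟩ := (h.mem v q).1 hq <;> omega
  have h1 := h.buckets.push (a e) (Nat.succ_ne_zero (2 * e))
    fun v hq => lt_irrefl _ (hlt v _ hq)
  have h2 := h1.push (b e) (Nat.succ_ne_zero (2 * e + 1)) fun v hq => by
    rcases mem_update_cons.1 hq with hq | hq
    · omega
    · have := hlt v _ hq; omega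
  refine ⟨_, h2, ?_, ?_, ?_⟩
  · intro v q
    rw [mem_update_cons, mem_update_cons, h.mem]
    constructor
    · rintro (⟨hq, hv⟩ | ⟨hq, hv⟩ | ⟨i, hi, hq⟩)
      · exact ⟨e, by omega, .inr ⟨hq, hv.symm⟩⟩
      · exact ⟨e, by omega, .inl ⟨hq, hv.symm⟩⟩
      · exact ⟨i, by omega, hq⟩
    · rintro ⟨i, hi, hq⟩
      rcases Nat.lt_succ_iff_lt_or_eq.1 hi with hi | rfl
      · exact .inr (.inr ⟨i, hi, hq⟩)
      · rcases hq with ⟨hq, hv⟩ | ⟨hq, hv⟩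
        · exact .inr (.inl ⟨hq, hv.symm⟩)
        · exact .inl ⟨hq, hv.symm⟩
  · intro i hi
    rcases Nat.lt_succ_iff_lt_or_eq.1 hi with hi | rfl
    · have := h.dst i hi
      simp only [Function.update_apply]
      rwa [if_neg (by omega), if_neg (by omega), if_neg (by omega), if_neg (by omega)]
    · simp
  · rw [sum_length_update_cons hb, sum_length_update_cons ha, h.size]
    omega

/-- Enter the edges into adjacency lists: word arrays `4`, `5` and `6` hold the heads, the
successors, and the neighbours. -/
def adjacencyCmd : Cmd :=
  .loop (.nlt (.reg 3) (.reg 1)) (block [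
    .storeN 5 (.add (.mul (.lit 2) (.reg 3)) (.lit 1)) (.get 4 (.get 0 (.reg 3))),
    .storeN 4 (.get 0 (.reg 3)) (.add (.mul (.lit 2) (.reg 3)) (.lit 1)),
    .storeN 6 (.add (.mul (.lit 2) (.reg 3)) (.lit 1)) (.get 1 (.reg 3)),
    .storeN 5 (.add (.mul (.lit 2) (.reg 3)) (.lit 2)) (.get 4 (.get 1 (.reg 3))),
    .storeN 4 (.get 1 (.reg 3)) (.add (.mul (.lit 2) (.reg 3)) (.lit 2)),
    .storeN 6 (.add (.mul (.lit 2) (.reg 3)) (.lit 2)) (.get 0 (.reg 3)),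
    .setN 3 (.add (.reg 3) (.lit 1))])

/-- Outside the word registers in `X` and the arrays in `A` and `B`, the memory is unchanged. -/
structure Frame (X A B : Finset ℕ) (s₀ s : State) : Prop where
  nreg : ∀ x ∉ X, s.nreg x = s₀.nreg x
  narr : ∀ a ∉ A, s.narr a = s₀.narr a
  rreg : s.rreg = s₀.rreg
  rarr : ∀ a ∉ B, s.rarr a = s₀.rarr a

theorem Frame.refl (X A B : Finset ℕ) (s : State) : Frame X A B s s :=
  ⟨fun _ _ => rfl, fun _ _ => rfl, rfl, fun _ _ => rfl⟩

section Frame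

variable {X A B : Finset ℕ} {s₀ s : State}

@[simp] theorem Frame.putN_iff {x k : ℕ} (hx : x ∈ X) :
    Frame X A B s₀ (s.putN x k) ↔ Frame X A B s₀ s := by
  have : ∀ y ∉ X, (s.putN x k).nreg y = s.nreg y := fun y hy => by
    rw [State.nreg_putN, if_neg]; rintro rfl; exact hy hx
  constructor <;> intro h <;>
    exact ⟨fun y hy => by rw [← h.nreg y hy, this y hy], h.narr, h.rreg, h.rarr⟩

@[simp] theorem Frame.putNArr_iff {a i k : ℕ} (ha : a ∈ A) :
    Frame X A B s₀ (s.putNArr a i k) ↔ Frame X A B s₀ s := by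
  have : ∀ y ∉ A, (s.putNArr a i k).narr y = s.narr y := fun y hy => by
    rw [State.narr_putNArr, if_neg]; rintro rfl; exact hy ha
  constructor <;> intro h <;>
    exact ⟨h.nreg, fun y hy => by rw [← h.narr y hy, this y hy], h.rreg, h.rarr⟩

@[simp] theorem Frame.putRArr_iff {a i : ℕ} {r : ℝ} (ha : a ∈ B) :
    Frame X A B s₀ (s.putRArr a i r) ↔ Frame X A B s₀ s := by
  have : ∀ y ∉ B, (s.putRArr a i r).rarr y = s.rarr y := fun y hy => by
    rw [State.rarr_putRArr, if_neg]; rintro rfl; exact hy ha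
  constructor <;> intro h <;>
    exact ⟨h.nreg, h.narr, h.rreg, fun y hy => by rw [← h.rarr y hy, this y hy]⟩

end Frame

theorem runs_adjacencyCmd {s₀ : State} {n m : ℕ} (hm : s₀.nreg 1 = m) (h3 : s₀.nreg 3 = 0)
    (h4 : s₀.narr 4 = fun _ => 0) (hW : 4 * m + 8 ≤ W)
    (hab : ∀ i < m, s₀.narr 0 i < n ∧ s₀.narr 1 i < n) {T : ℕ} (hT : 100 * m + 100 ≤ T)
    {Q : State → ℕ → Prop}
    (hQ : ∀ s T', Frame {3} {4, 5, 6} ∅ s₀ s →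
      (∃ L, EdgeLists n (s₀.narr 0) (s₀.narr 1) m (s.narr 4) (s.narr 5) (s.narr 6) L) →
      T ≤ T' + (100 * m + 100) → Q s T') :
    Runs W adjacencyCmd s₀ T Q := by
  -- The two budget clauses recur in most of the counted loops below: the first bounds what has been
  -- spent so far, the second keeps enough for the remaining rounds, at 100 steps each.
  refine Runs.loop (fun s T' => ∃ e ≤ m, s.nreg 3 = e ∧ Frame {3} {4, 5, 6} ∅ s₀ s ∧
    (∃ L, EdgeLists n (s₀.narr 0) (s₀.narr 1) e (s.narr 4) (s.narr 5) (s.narr 6) L) ∧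
    T + 100 * (m - e) ≤ T' + 100 * m ∧ 100 * (m - e) + 100 ≤ T') ?_ ?_
  · rintro s T' ⟨e, he, hs3, hfr, ⟨L, hL⟩, hT1, hT2⟩
    have hs1 : s.nreg 1 = m := by rw [hfr.nreg 1 (by decide), hm]
    have hs0 : s.narr 0 = s₀.narr 0 := hfr.narr 0 (by decide)
    have hs1' : s.narr 1 = s₀.narr 1 := hfr.narr 1 (by decide)
    refine ⟨by simp, by simp; omega, ?_, ?_⟩
    · intro hlt
      simp only [BExp.Holds, NExp.val, hs3, hs1] at hlt
      obtain ⟨ha, hb⟩ := hab e hlt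
      obtain ⟨L', hL'⟩ := hL.push ha hb
      refine Runs.of_vc (by simp; omega) ?_
      simp only [block, Cmd.vc, NExp.val, NExp.Safe]
      simp [hs3, hs0, hs1', hfr]
      exact ⟨by omega, by omega, by omega, fun T₁ h => ⟨hlt, ⟨L', hL'⟩, by omega, by omega⟩⟩
    · intro hlt
      simp only [BExp.Holds, NExp.val, hs3, hs1] at hlt
      obtain rfl : e = m := by omega
      exact hQ s _ hfr ⟨L, hL⟩ (by simp; omega)
  · refine ⟨0, by omega, h3, Frame.refl _ _ _ _,
      ⟨fun _ => [], ?_, ?_, ?_, ?_⟩, by omega, by omega⟩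
    · intro b; simp [Chain, h4]
    · simp
    · simp
    · simp

/-- Adjacency lists of the graph `G` with `m` edges: the list `L v` holds one cell for each
neighbour of `v`. -/
structure AdjacencyLists {n : ℕ} (G : SimpleGraph (Fin n)) (m : ℕ) (head nxt dst : ℕ → ℕ)
    (L : ℕ → List ℕ) : Prop where
  buckets : Buckets head nxt L
  adj : ∀ v : Fin n, ∀ q ∈ L v, ∃ u : Fin n, dst q = u ∧ G.Adj v u
  exists_mem : ∀ v u : Fin n, G.Adj v u → ∃ q ∈ L v, dst q = u
  size : ∑ v ∈ Finset.range n, (L v).length = 2 * m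

theorem padded_of_lt {α : Type*} [Zero α] {n : ℕ} (f : Fin n → α) {i : ℕ} (h : i < n) :
    padded f i = f ⟨i, h⟩ := dif_pos h

theorem EdgeLists.adjacencyLists {n : ℕ} {G : SimpleGraph (Fin n)} {l : List (Fin n × Fin n)}
    (hl : IsEdgeList G l) {head nxt dst : ℕ → ℕ} {L : ℕ → List ℕ}
    (h : EdgeLists n (padded fun i : Fin l.length => ((l.get i).1 : ℕ))
      (padded fun i : Fin l.length => ((l.get i).2 : ℕ)) l.length head nxt dst L) :
    AdjacencyLists G l.length head nxt dst L where
  buckets := h.buckets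
  adj v q hq := by
    obtain ⟨i, hi, hq⟩ := (h.mem v q).1 hq
    obtain ⟨h1, h2⟩ := h.dst i hi
    rw [padded_of_lt _ hi] at h1 h2
    rw [padded_of_lt _ hi, padded_of_lt _ hi] at hq
    have hA : G.Adj (l.get ⟨i, hi⟩).1 (l.get ⟨i, hi⟩).2 :=
      (hl.2 s((l.get ⟨i, hi⟩).1, (l.get ⟨i, hi⟩).2)).1
        (List.mem_map.2 ⟨_, List.get_mem l ⟨i, hi⟩, rfl⟩)
    rcases hq with ⟨rfl, hv⟩ | ⟨rfl, hv⟩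
    · exact ⟨_, h1, Fin.ext hv ▸ hA⟩
    · exact ⟨_, h2, Fin.ext hv ▸ hA.symm⟩
  exists_mem v u hA := by
    obtain ⟨p, hp, he⟩ := List.mem_map.1 ((hl.2 s(v, u)).2 hA)
    obtain ⟨⟨i, hi⟩, rfl⟩ := List.get_of_mem hp
    obtain ⟨h1, h2⟩ := h.dst i hi
    rw [padded_of_lt _ hi] at h1 h2
    rcases Sym2.eq_iff.1 he with ⟨e1, e2⟩ | ⟨e1, e2⟩
    · exact ⟨2 * i + 1, (h.mem _ _).2 ⟨i, hi, .inl ⟨rfl, by rw [padded_of_lt _ hi, e1]⟩⟩,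
        by rw [h1, e2]⟩
    · exact ⟨2 * i + 2, (h.mem _ _).2 ⟨i, hi, .inr ⟨rfl, by rw [padded_of_lt _ hi, e2]⟩⟩,
        by rw [h2, e1]⟩
  size := h.size

/-- This crude bound makes the edge counters and cell numbers fit into words of size polynomial in
`n`. -/
theorem IsEdgeList.length_le {n : ℕ} {G : SimpleGraph (Fin n)} {l : List (Fin n × Fin n)}
    (hl : IsEdgeList G l) : l.length ≤ n * n := by
  have h1 : (l.map fun p => s(p.1, p.2)).Nodup := hl.1
  have h2 : l.Nodup := List.Nodup.of_map _ h1
  simpa using h2.length_le_card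

/-- The vertices of `o` are written into the first `k` cells of `ord`. -/
def Lists {n : ℕ} (ord : ℕ → ℕ) (k : ℕ) (o : List (Fin n)) : Prop :=
  (List.range k).map ord = o.map Fin.val

theorem Lists.snoc {n : ℕ} {ord : ℕ → ℕ} {k : ℕ} {o : List (Fin n)} (h : Lists ord k o)
    (v : Fin n) : Lists (Function.update ord k v) (k + 1) (o ++ [v]) := by
  rw [Lists, List.range_succ, List.map_append, List.map_append, ← h]
  congr 1
  · exact List.map_congr_left fun i hi =>
      Function.update_of_ne (List.mem_range.1 hi).ne _ _
  · simp

theorem Lists.length_eq {n : ℕ} {ord : ℕ → ℕ} {k : ℕ} {o : List (Fin n)} (h : Lists ord k o) :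
    o.length = k := by
  simpa using (congrArg List.length h).symm

/-- The list `o` contains every vertex that has a neighbour, and the weights along it decrease by a
factor of at most two. -/
structure NearlySorted {n : ℕ} (G : SimpleGraph (Fin n)) (w : Fin n → ℝ) (o : List (Fin n)) :
    Prop where
  nodup : o.Nodup
  sorted : o.Pairwise fun a b => w a ≤ 2 * w b
  mem : ∀ v u, G.Adj v u → v ∈ o

/-! ### Sorting by a tournament tree -/

/-- The key of the entry `t` of a tournament tree; `n` is the empty entry. -/
noncomputable def treeKey (n : ℕ) (w : ℕ → ℝ) (t : ℕ) : WithTop ℝ := if t = n then ⊤ else (w t : ℝ)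

open Classical in
/-- The winner among the two children of the node `i`. -/
noncomputable def winner (n : ℕ) (w : ℕ → ℝ) (t : ℕ → ℕ) (i : ℕ) : ℕ :=
  if treeKey n w (t (2 * i + 1)) < treeKey n w (t (2 * i)) then t (2 * i + 1) else t (2 * i)

/-- A tournament tree on the set `S ⊆ {0, …, n - 1}` with inner nodes `1, …, n - 1` and leaves
`n, …, 2 n - 1`, in which the nodes in `B` may be out of date. -/
structure Tournament (n : ℕ) (w : ℕ → ℝ) (S : Finset ℕ) (B : ℕ → Prop) (t : ℕ → ℕ) : Prop where
  subset : ∀ v ∈ S, v < n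
  leaf : ∀ v < n, t (n + v) = if v ∈ S then v else n
  inner : ∀ i, 1 ≤ i → i < n → ¬ B i → t i = winner n w t i

section Tournament

variable {n : ℕ} {w : ℕ → ℝ} {S : Finset ℕ} {B B' : ℕ → Prop} {t : ℕ → ℕ}

theorem winner_congr {t t' : ℕ → ℕ} {i : ℕ} (h0 : t' (2 * i) = t (2 * i))
    (h1 : t' (2 * i + 1) = t (2 * i + 1)) : winner n w t' i = winner n w t i := by
  rw [winner, winner, h0, h1]

/-- Recomputing node `i` repairs `i` and can invalidate only its parent; `hB` says that the new set
of stale nodes allows for this. -/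
theorem Tournament.pull (h : Tournament n w S B t) {i : ℕ} (hi : 1 ≤ i) (hin : i < n)
    (hB : ∀ j, 1 ≤ j → j < n → ¬ B' j → j = i ∨ (¬ B j ∧ 2 * j ≠ i ∧ 2 * j + 1 ≠ i)) :
    Tournament n w S B' (Function.update t i (winner n w t i)) where
  subset := h.subset
  leaf v hv := by rw [Function.update_of_ne (by omega), h.leaf v hv]
  inner j hj hjn hBj := by
    have hw : 2 * j ≠ i → 2 * j + 1 ≠ i →
        winner n w (Function.update t i (winner n w t i)) j = winner n w t j := fun h1 h2 =>
      winner_congr (Function.update_of_ne h1 _ _) (Function.update_of_ne h2 _ _)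
    by_cases hji : j = i
    · subst hji
      rw [Function.update_self, hw (by omega) (by omega)]
    · obtain hb | ⟨hb, h1, h2⟩ := hB j hj hjn hBj
      · exact (hji hb).elim
      · rw [Function.update_of_ne hji, hw h1 h2, h.inner j hj hjn hb]

/-- Emptying one leaf can make only its ancestors stale, and these are its iterated halves. -/
theorem Tournament.erase (h : Tournament n w S B t) (hB : ∀ j, ¬ B j) (v : ℕ) (hv : v < n) :
    Tournament n w (S.erase v) (fun j => ∃ r, j = (n + v) / 2 / 2 ^ r)
      (Function.update t (n + v) n) where
  subset u hu := h.subset u (Finset.mem_of_mem_erase hu)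
  leaf u hu := by
    by_cases huv : u = v
    · subst huv; simp
    · rw [Function.update_of_ne (by omega), h.leaf u hu]
      simp [huv]
  inner j hj hjn hBj := by
    have hne : j ≠ (n + v) / 2 := fun he => hBj ⟨0, by simpa using he⟩
    rw [Function.update_of_ne (by omega), winner_congr (Function.update_of_ne (by omega) _ _)
      (Function.update_of_ne (by omega) _ _)]
    exact h.inner j hj hjn (hB j)

theorem winner_eq_or (i : ℕ) : winner n w t i = t (2 * i) ∨ winner n w t i = t (2 * i + 1) := by
  rw [winner]; split_ifs <;> simp

theorem treeKey_winner_le (i : ℕ) : treeKey n w (winner n w t i) ≤ treeKey n w (t (2 * i)) ∧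
    treeKey n w (winner n w t i) ≤ treeKey n w (t (2 * i + 1)) := by
  rw [winner]
  split_ifs with h
  · exact ⟨h.le, le_rfl⟩
  · exact ⟨le_rfl, not_lt.1 h⟩

theorem Tournament.eq_or_mem (h : Tournament n w S B t) (hB : ∀ j, ¬ B j) {j : ℕ} (hj : 1 ≤ j)
    (hjn : j < 2 * n) : t j = n ∨ t j ∈ S := by
  induction hd : 2 * n - j using Nat.strong_induction_on generalizing j with
  | _ d ih =>
    by_cases hlt : j < n
    · rw [h.inner j hj hlt (hB j)]
      rcases winner_eq_or (n := n) (w := w) (t := t) j with e | e <;> rw [e]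
      · exact ih _ (by omega) (by omega) (by omega) rfl
      · exact ih _ (by omega) (by omega) (by omega) rfl
    · obtain ⟨v, rfl⟩ := Nat.exists_eq_add_of_le (not_lt.1 hlt)
      rw [h.leaf v (by omega)]
      split_ifs with hv <;> simp [hv]

/-- Keys do not decrease from a parent `j / 2` to its child `j`. The tree need not be complete, so
`n` need not be a power of two; for `n = 1` the root is itself a leaf. -/
theorem Tournament.root_le (h : Tournament n w S B t) (hB : ∀ j, ¬ B j) {j : ℕ} (hj : 1 ≤ j)
    (hjn : j < 2 * n) : treeKey n w (t 1) ≤ treeKey n w (t j) := by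
  induction j using Nat.strong_induction_on with
  | _ j ih =>
    rcases Nat.eq_or_lt_of_le hj with rfl | hj1
    · exact le_rfl
    · refine (ih (j / 2) (by omega) (by omega) (by omega)).trans ?_
      rw [h.inner (j / 2) (by omega) (by omega) (hB _)]
      obtain ⟨h1, h2⟩ := treeKey_winner_le (n := n) (w := w) (t := t) (j / 2)
      rcases Nat.even_or_odd' j with ⟨c, rfl | rfl⟩
      · rwa [Nat.mul_div_cancel_left c two_pos] at *
      · rwa [show (2 * c + 1) / 2 = c by omega] at *

theorem Tournament.root_min (h : Tournament n w S B t) (hB : ∀ j, ¬ B j) (h1 : t 1 ≠ n)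
    {u : ℕ} (hu : u ∈ S) : w (t 1) ≤ w u := by
  have hun := h.subset u hu
  have hle := h.root_le hB (show 1 ≤ n + u by omega) (by omega)
  rw [h.leaf u hun, if_pos hu, treeKey, treeKey, if_neg h1, if_neg hun.ne] at hle
  exact WithTop.coe_le_coe.1 hle

theorem Tournament.eq_empty (h : Tournament n w S B t) (hB : ∀ j, ¬ B j) (h1 : t 1 = n) :
    S = ∅ := by
  refine Finset.eq_empty_of_forall_notMem fun u hu => ?_
  have hun := h.subset u hu
  have hle := h.root_le hB (show 1 ≤ n + u by omega) (by omega)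
  rw [h.leaf u hun, if_pos hu, treeKey, treeKey, if_pos h1, if_neg hun.ne] at hle
  simp at hle

end Tournament

/-- Update the node whose number is in word register `3`. -/
def pullCmd : Cmd :=
  .ite (.and (.not (.neq (.get 8 (.add (.mul (.lit 2) (.reg 3)) (.lit 1))) (.reg 0)))
      (.not (.and (.not (.neq (.get 8 (.mul (.lit 2) (.reg 3))) (.reg 0)))
        (.not (.rlt (.get 0 (.get 8 (.add (.mul (.lit 2) (.reg 3)) (.lit 1))))
          (.get 0 (.get 8 (.mul (.lit 2) (.reg 3)))))))))
    (.storeN 8 (.reg 3) (.get 8 (.add (.mul (.lit 2) (.reg 3)) (.lit 1))))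
    (.storeN 8 (.reg 3) (.get 8 (.mul (.lit 2) (.reg 3))))

theorem vc_pullCmd {s : State} {Q : State → Prop} (hW : 2 * s.nreg 3 + 4 ≤ W)
    (hQ : Q (s.putNArr 8 (s.nreg 3) (winner (s.nreg 0) (s.rarr 0) (s.narr 8) (s.nreg 3)))) :
    pullCmd.vc W Q s := by
  -- The test compares keys with `n` as infinity. Since `and` evaluates both sides, the weight at
  -- index `n` may be read, but its value never affects the outcome.
  have hiff : (¬ s.narr 8 (2 * s.nreg 3 + 1) = s.nreg 0 ∧ ¬ (¬ s.narr 8 (2 * s.nreg 3) = s.nreg 0 ∧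
      ¬ s.rarr 0 (s.narr 8 (2 * s.nreg 3 + 1)) < s.rarr 0 (s.narr 8 (2 * s.nreg 3)))) ↔
      treeKey (s.nreg 0) (s.rarr 0) (s.narr 8 (2 * s.nreg 3 + 1))
        < treeKey (s.nreg 0) (s.rarr 0) (s.narr 8 (2 * s.nreg 3)) := by
    rw [treeKey, treeKey]
    split_ifs with h1 h2 h2 <;> simp [h1, h2]
  have h1 : 1 < W := by omega
  have h2 : 2 < W := by omega
  have h3 : 2 * s.nreg 3 < W := by omega
  have h4 : 2 * s.nreg 3 + 1 < W := by omega
  simp only [pullCmd, Cmd.vc, BExp.Safe, BExp.Holds, NExp.Safe, NExp.val, RExp.Safe, RExp.val,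
    hiff]
  refine ⟨by simp only [h1, h2, h3, h4, and_self], fun h => ?_, fun h => ?_⟩
  · rw [winner, if_pos h] at hQ
    simpa only [h1, h2, h3, h4, and_self, true_and] using hQ
  · rw [winner, if_neg h] at hQ
    simpa only [h1, h2, h3, h4, and_self, true_and] using hQ

/-- Initialize the leaves of the tournament tree in word array `8`. -/
def treeLeavesCmd : Cmd :=
  .loop (.nlt (.reg 3) (.reg 0)) (block [
    .ite (.neq (.get 4 (.reg 3)) (.lit 0))
      (.storeN 8 (.add (.reg 0) (.reg 3)) (.reg 0))
      (.storeN 8 (.add (.reg 0) (.reg 3)) (.reg 3)),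
    .setN 3 (.add (.reg 3) (.lit 1))])

/-- Initialize the inner nodes of the tournament tree. -/
def treeBuildCmd : Cmd :=
  .loop (.nlt (.lit 1) (.reg 3)) (.seq (.setN 3 (.sub (.reg 3) (.lit 1))) pullCmd)

/-- Update the ancestors of a node of the tournament tree. -/
def treeClimbCmd : Cmd :=
  .loop (.nlt (.lit 0) (.reg 3)) (.seq pullCmd (.setN 3 (.div (.reg 3) (.lit 2))))

/-- Repeatedly extract the winner of the tournament. -/
def treeExtractCmd : Cmd :=
  .loop (.not (.neq (.get 8 (.lit 1)) (.reg 0))) (.seq (block [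
    .setN 7 (.get 8 (.lit 1)),
    .storeN 7 (.reg 4) (.reg 7),
    .setN 4 (.add (.reg 4) (.lit 1)),
    .storeN 8 (.add (.reg 0) (.reg 7)) (.reg 0),
    .setN 3 (.div (.add (.reg 0) (.reg 7)) (.lit 2))]) treeClimbCmd)

theorem runs_treeLeavesCmd {s₀ : State} {n : ℕ} (hn : s₀.nreg 0 = n) (h3 : s₀.nreg 3 = 0)
    (hW : 2 * n + 8 ≤ W) {T : ℕ} (hT : 100 * n + 100 ≤ T) {Q : State → ℕ → Prop}
    (hQ : ∀ s T', Frame {3, 4, 7} {7, 8} ∅ s₀ s → s.nreg 3 = n → s.nreg 4 = s₀.nreg 4 →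
      (∀ v < n, s.narr 8 (n + v) = if s₀.narr 4 v = 0 then n else v) →
      T ≤ T' + (100 * n + 100) → Q s T') :
    Runs W treeLeavesCmd s₀ T Q := by
  refine Runs.loop (fun s T' => ∃ e ≤ n, s.nreg 3 = e ∧ Frame {3, 4, 7} {7, 8} ∅ s₀ s ∧
    s.nreg 4 = s₀.nreg 4 ∧ (∀ v < e, s.narr 8 (n + v) = if s₀.narr 4 v = 0 then n else v) ∧
    T + 100 * (n - e) ≤ T' + 100 * n ∧ 100 * (n - e) + 100 ≤ T') ?_ ?_
  · rintro s T' ⟨e, he, hs3, hfr, hs4, hl, hT1, hT2⟩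
    have hs0 : s.nreg 0 = n := by rw [hfr.nreg 0 (by decide), hn]
    have hs4' : s.narr 4 = s₀.narr 4 := hfr.narr 4 (by decide)
    refine ⟨by simp, by simp; omega, ?_, ?_⟩
    · intro hlt
      simp only [BExp.Holds, NExp.val, hs3, hs0] at hlt
      refine Runs.of_vc (by simp; omega) ?_
      have key : ∀ x, x = (if s₀.narr 4 e = 0 then n else e) → ∀ v < e + 1,
          Function.update (s.narr 8) (n + e) x (n + v) = if s₀.narr 4 v = 0 then n else v := by
        rintro x rfl v hv
        rcases Nat.lt_succ_iff_lt_or_eq.1 hv with hv | rfl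
        · rw [Function.update_of_ne (by omega), hl v hv]
        · rw [Function.update_self]
      simp only [block, Cmd.vc, NExp.val, NExp.Safe, BExp.Safe, BExp.Holds]
      simp only [hs3, hs0, hs4', State.nreg_putNArr, if_true, State.nreg_putN]
      refine ⟨⟨trivial, by omega⟩, fun h => ?_, fun h => ?_⟩ <;>
      · simp [hfr, hs4]
        exact ⟨by omega, by omega, fun T₁ h1 => ⟨hlt, fun v hv => key _ (by simp [h]) v (by omega),
          by omega, by omega⟩⟩
    · intro hlt
      simp only [BExp.Holds, NExp.val, hs3, hs0] at hlt
      obtain rfl : e = n := by omega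
      exact hQ s _ hfr hs3 hs4 hl (by simp; omega)
  · exact ⟨0, by omega, h3, Frame.refl _ _ _ _, rfl, by simp, by omega, by omega⟩

theorem runs_treeBuildCmd {s₀ : State} {n : ℕ} {S : Finset ℕ} (hn : s₀.nreg 0 = n) (hn0 : 0 < n)
    (h3 : s₀.nreg 3 = n) (hS : ∀ v ∈ S, v < n)
    (hleaf : ∀ v < n, s₀.narr 8 (n + v) = if v ∈ S then v else n)
    (hW : 2 * n + 8 ≤ W) {T : ℕ} (hT : 100 * n + 100 ≤ T) {Q : State → ℕ → Prop}
    (hQ : ∀ s T', Frame {3, 4, 7} {7, 8} ∅ s₀ s → s.nreg 4 = s₀.nreg 4 →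
      Tournament n (s₀.rarr 0) S (fun _ => False) (s.narr 8) →
      T ≤ T' + (100 * n + 100) → Q s T') :
    Runs W treeBuildCmd s₀ T Q := by
  refine Runs.loop (fun s T' => ∃ e ≤ n, 1 ≤ e ∧ s.nreg 3 = e ∧ Frame {3, 4, 7} {7, 8} ∅ s₀ s ∧
    s.nreg 4 = s₀.nreg 4 ∧ Tournament n (s₀.rarr 0) S (fun i => i < e) (s.narr 8) ∧
    T + 100 * e ≤ T' + 100 * n ∧ 100 * e + 100 ≤ T') ?_ ?_
  · rintro s T' ⟨e, he, he1, hs3, hfr, hs4, ht, hT1, hT2⟩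
    have hs0 : s.nreg 0 = n := by rw [hfr.nreg 0 (by decide), hn]
    have hr0 : s.rarr 0 = s₀.rarr 0 := hfr.rarr 0 (by decide)
    refine ⟨by simp; omega, by simp; omega, ?_, ?_⟩
    · intro hlt
      simp only [BExp.Holds, NExp.val, hs3] at hlt
      refine Runs.of_vc (by simp [pullCmd]; omega) ?_
      rw [Cmd.vc, Cmd.vc]
      refine ⟨by simp [hs3]; omega, vc_pullCmd (by simp [hs3]; omega) fun T₁ hT₁ => ?_⟩
      simp [pullCmd] at hT₁
      refine ⟨e - 1, by omega, by omega, by simp [hs3], by simp [hfr], by simp [hs4], ?_,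
        by omega, by omega⟩
      simp [hs3, hs0, hr0]
      exact ht.pull (by omega) (by omega) fun j h1 h2 h3 => by omega
    · intro hlt
      simp only [BExp.Holds, NExp.val, hs3] at hlt
      refine hQ s _ hfr hs4 ⟨ht.subset, ht.leaf, fun i h1 h2 _ => ht.inner i h1 h2 (by omega)⟩
        (by simp; omega)
  · exact ⟨n, le_rfl, hn0, h3, Frame.refl _ _ _ _, rfl,
      ⟨hS, hleaf, fun i _ h1 h2 => (h2 h1).elim⟩, by omega, by omega⟩

/-- The stale nodes are always the current node and its ancestors. The node number stays below `2 ^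
e` while `e` drops by one per round, which bounds the rounds by `h`. -/
theorem runs_treeClimbCmd {s₀ : State} {n h : ℕ} {S : Finset ℕ} {w : ℕ → ℝ} (hn : s₀.nreg 0 = n)
    (hi : s₀.nreg 3 < n) (hh : n ≤ 2 ^ h) (hw : s₀.rarr 0 = w)
    (ht : Tournament n w S (fun j => ∃ r, j = s₀.nreg 3 / 2 ^ r) (s₀.narr 8))
    (hW : 2 * n + 8 ≤ W) {T : ℕ} (hT : 100 * h + 100 ≤ T) {Q : State → ℕ → Prop}
    (hQ : ∀ s T', Frame {3} {8} ∅ s₀ s →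
      Tournament n w S (fun _ => False) (s.narr 8) →
      T ≤ T' + (100 * h + 100) → Q s T') :
    Runs W treeClimbCmd s₀ T Q := by
  refine Runs.loop (fun s T' => ∃ i e, i < n ∧ i < 2 ^ e ∧ s.nreg 3 = i ∧ Frame {3} {8} ∅ s₀ s ∧
    Tournament n w S (fun j => ∃ r, j = i / 2 ^ r) (s.narr 8) ∧
    T + 100 * e ≤ T' + 100 * h ∧ 100 * e + 100 ≤ T') ?_ ?_
  · rintro s T' ⟨i, e, hin, hie, hs3, hfr, ht, hT1, hT2⟩
    have hs0 : s.nreg 0 = n := by rw [hfr.nreg 0 (by decide), hn]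
    have hr0 : s.rarr 0 = w := by rw [hfr.rarr 0 (by decide), hw]
    refine ⟨by simp; omega, by simp; omega, ?_, ?_⟩
    · intro hlt
      simp only [BExp.Holds, NExp.val, hs3] at hlt
      obtain ⟨e, rfl⟩ : ∃ e', e = e' + 1 := by
        cases e with
        | zero => simp at hie; omega
        | succ e => exact ⟨e, rfl⟩
      rw [pow_succ] at hie
      refine Runs.of_vc (by simp [pullCmd]; omega) ?_
      rw [Cmd.vc]
      refine vc_pullCmd (by omega) ?_
      rw [Cmd.vc]
      refine ⟨by simp [hs3]; omega, fun T₁ hT₁ => ?_⟩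
      simp [pullCmd] at hT₁
      refine ⟨i / 2, e, by omega, by omega, by simp [hs3], by simp [hfr], ?_,
        by omega, by omega⟩
      simp [hs3, hs0, hr0]
      -- The parent of `i` is `i / 2`, which still counts as stale; the other ancestors of `i` are
      -- the further halves of `i / 2`.
      refine ht.pull (by omega) (by omega) fun j h1 h2 h3 => ?_
      by_cases hji : j = i
      · exact .inl hji
      · refine .inr ⟨?_, ?_, ?_⟩
        · rintro ⟨r, hr⟩
          cases r with
          | zero => exact hji (by simpa using hr)
          | succ r => exact h3 ⟨r, by rw [hr, pow_succ', Nat.div_div_eq_div_mul]⟩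
        · intro hj; exact h3 ⟨0, by simp; omega⟩
        · intro hj; exact h3 ⟨0, by simp; omega⟩
    · intro hlt
      simp only [BExp.Holds, NExp.val, hs3] at hlt
      obtain rfl : i = 0 := by omega
      refine hQ s _ hfr ⟨ht.subset, ht.leaf, fun i h1 h2 _ => ht.inner i h1 h2 ?_⟩
        (by simp; omega)
      -- All halves of 0 are 0, which is not a node, so nothing is stale any more.
      rintro ⟨r, hr⟩
      simp at hr
      omega
  · exact ⟨_, h, hi, hi.trans_le hh, rfl, Frame.refl _ _ _ _, ht, by omega, by omega⟩

theorem Frame.trans {X A B X' A' B' : Finset ℕ} {s₀ s₁ s₂ : State} (h : Frame X A B s₀ s₁)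
    (h' : Frame X' A' B' s₁ s₂) (hX : X' ⊆ X) (hA : A' ⊆ A) (hB : B' ⊆ B) :
    Frame X A B s₀ s₂ where
  nreg x hx := by rw [h'.nreg x fun hx' => hx (hX hx'), h.nreg x hx]
  narr a ha := by rw [h'.narr a fun ha' => ha (hA ha'), h.narr a ha]
  rreg := by rw [h'.rreg, h.rreg]
  rarr b hb := by rw [h'.rarr b fun hb' => hb (hB hb'), h.rarr b hb]

theorem runs_treeExtractCmd {s₀ : State} {n h : ℕ} {S₀ : Finset ℕ} {w : Fin n → ℝ}
    (hn : s₀.nreg 0 = n) (hn0 : 0 < n) (h4 : s₀.nreg 4 = 0) (hh : n ≤ 2 ^ h)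
    (hw : ∀ v : Fin n, s₀.rarr 0 v = w v)
    (ht₀ : Tournament n (s₀.rarr 0) S₀ (fun _ => False) (s₀.narr 8))
    (hW : 2 * n + 8 ≤ W) {T : ℕ} (hT : S₀.card * (100 * h + 300) + 100 ≤ T)
    {Q : State → ℕ → Prop}
    (hQ : ∀ s T', Frame {3, 4, 7} {7, 8} ∅ s₀ s →
      (∃ o : List (Fin n), Lists (s.narr 7) (s.nreg 4) o ∧ o.Nodup ∧
        o.Pairwise (fun a b => w a ≤ w b) ∧ ∀ v : Fin n, (v : ℕ) ∈ S₀ → v ∈ o) →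
      T ≤ T' + (S₀.card * (100 * h + 300) + 100) → Q s T') :
    Runs W treeExtractCmd s₀ T Q := by
  -- The cost of one extraction is made opaque, so that its product with a cardinality is a single
  -- atom for linear arithmetic.
  obtain ⟨C, hC⟩ : ∃ C, C = 100 * h + 300 := ⟨_, rfl⟩
  simp only [← hC] at hT hQ
  refine Runs.loop (fun s T' => ∃ (S : Finset ℕ) (o : List (Fin n)),
    Frame {3, 4, 7} {7, 8} ∅ s₀ s ∧ Lists (s.narr 7) (s.nreg 4) o ∧ o.Nodup ∧
    o.Pairwise (fun a b => w a ≤ w b) ∧ (∀ v : Fin n, (v : ℕ) ∈ S₀ → v ∈ o ∨ (v : ℕ) ∈ S) ∧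
    (∀ a ∈ o, (a : ℕ) ∉ S) ∧ (∀ a ∈ o, ∀ u : Fin n, (u : ℕ) ∈ S → w a ≤ w u) ∧
    Tournament n (s₀.rarr 0) S (fun _ => False) (s.narr 8) ∧
    T + S.card * C ≤ T' + S₀.card * C ∧ S.card * C + 100 ≤ T') ?_ ?_
  · rintro s T' ⟨S, o, hfr, hl, hnd, hsort, hmem, hdis, hle, ht, hT1, hT2⟩
    have hs0 : s.nreg 0 = n := by rw [hfr.nreg 0 (by decide), hn]
    have hr0 : s.rarr 0 = s₀.rarr 0 := hfr.rarr 0 (by decide)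
    refine ⟨by simp; omega, by simp; omega, ?_, ?_⟩
    · intro hlt
      simp only [BExp.Holds, NExp.val, hs0] at hlt
      have hk : s.nreg 4 ≤ n := by
        rw [← hl.length_eq]; simpa using hnd.length_le_card
      have hvS : s.narr 8 1 ∈ S :=
        (ht.eq_or_mem (fun _ => not_false) le_rfl (by omega)).resolve_left hlt
      have hvn := ht.subset _ hvS
      obtain ⟨v, hv⟩ : ∃ v : Fin n, (v : ℕ) = s.narr 8 1 := ⟨⟨_, hvn⟩, rfl⟩
      have hcard : (S.erase v).card * C + C = S.card * C := by
        rw [← Nat.succ_mul, Nat.succ_eq_add_one, Finset.card_erase_add_one (by rwa [hv])]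
      refine Runs.seq (Runs.of_vc (by simp; omega) ?_)
      simp only [block, Cmd.vc, NExp.val, NExp.Safe]
      simp [hs0]
      refine ⟨by omega, by omega, by omega, by omega, fun T₁ hT₁ => ?_⟩
      have ht' := ht.erase (fun _ => not_false) v (by omega)
      refine runs_treeClimbCmd (n := n) (h := h) (S := S.erase v) (w := s₀.rarr 0) (by simp [hs0])
        (by simp; omega) hh (by simp [hr0]) (by simpa [hv] using ht') hW (by omega) ?_
      intro s₂ T₂ hfr₂ ht₂ hT₂
      have hfr₃ : Frame {3, 4, 7} {7, 8} ∅ s₀ s₂ := by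
        refine Frame.trans ?_ hfr₂ (by simp) (by simp) subset_rfl
        simp [hfr]
      refine ⟨hfr₃, S.erase v, o ++ [v], ?_, ?_, ?_, ?_, ?_, ?_, ht₂, by omega, by omega⟩
      · rw [hfr₂.nreg 4 (by decide), hfr₂.narr 7 (by decide)]
        simpa [hv] using hl.snoc v
      · rw [List.nodup_append]
        refine ⟨hnd, List.nodup_singleton _, fun a ha b hb => ?_⟩
        rw [List.mem_singleton] at hb
        rintro rfl
        exact hdis a ha (by rwa [hb, hv])
      · rw [List.pairwise_append]
        refine ⟨hsort, List.pairwise_singleton _ _, fun a ha b hb => ?_⟩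
        rw [List.mem_singleton] at hb
        exact hle a ha b (by rwa [hb, hv])
      · intro u hu
        by_cases huv : u = v
        · simp [huv]
        · have : (u : ℕ) ≠ v := fun he => huv (Fin.ext he)
          simpa [huv, this] using hmem u hu
      · intro a ha
        rcases List.mem_append.1 ha with ha | ha
        · exact fun h => hdis a ha (Finset.mem_of_mem_erase h)
        · rw [List.mem_singleton.1 ha]
          exact Finset.notMem_erase _ _
      · intro a ha u hu
        have huS := Finset.mem_of_mem_erase hu
        rcases List.mem_append.1 ha with ha | ha
        · exact hle a ha u huS
        · rw [List.mem_singleton.1 ha, ← hw, ← hw, hv]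
          exact ht.root_min (fun _ => not_false) hlt huS
    · intro hlt
      simp only [BExp.Holds, NExp.val, hs0, not_not] at hlt
      have hS := ht.eq_empty (fun _ => not_false) hlt
      subst hS
      refine hQ s _ hfr ⟨o, hl, hnd, hsort, fun v hv => ?_⟩ (by simp at hT1 ⊢; omega)
      simpa using hmem v hv
  · refine ⟨S₀, [], Frame.refl _ _ _ _, by simp [Lists, h4], List.nodup_nil, List.Pairwise.nil,
      fun v hv => .inr hv, by simp, by simp, ht₀, by omega, by omega⟩

/-- Write the vertices with a neighbour into word array `7`, by increasing weight. -/
def treeSortCmd : Cmd :=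
  block [.setN 3 (.lit 0), treeLeavesCmd, treeBuildCmd, treeExtractCmd]

/-- Isolated vertices never enter the tree. At most `2 * m` vertices remain, hence a cost of order
`n + m * h`, not `n * h`. -/
theorem runs_treeSortCmd {s₀ : State} {n m h : ℕ} {G : SimpleGraph (Fin n)} {L : ℕ → List ℕ}
    {w : Fin n → ℝ} (hn : s₀.nreg 0 = n) (hn0 : 0 < n) (h4 : s₀.nreg 4 = 0) (hh : n ≤ 2 ^ h)
    (hw : ∀ v : Fin n, s₀.rarr 0 v = w v) (hpos : ∀ v, 0 < w v)
    (hL : AdjacencyLists G m (s₀.narr 4) (s₀.narr 5) (s₀.narr 6) L)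
    (hW : 2 * n + 8 ≤ W) {T : ℕ} (hT : 200 * n + 2 * m * (100 * h + 300) + 400 ≤ T)
    {Q : State → ℕ → Prop}
    (hQ : ∀ s T', Frame {3, 4, 7} {7, 8} ∅ s₀ s →
      (∃ o : List (Fin n), Lists (s.narr 7) (s.nreg 4) o ∧ NearlySorted G w o) →
      T ≤ T' + (200 * n + 2 * m * (100 * h + 300) + 400) → Q s T') :
    Runs W treeSortCmd s₀ T Q := by
  set S : Finset ℕ := (Finset.range n).filter fun v => s₀.narr 4 v ≠ 0 with hS
  -- Each vertex of `S` has a nonempty adjacency list, and the lengths of the lists sum to `2 * m`.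
  have hcard : S.card ≤ 2 * m := by
    rw [← hL.size, Finset.card_filter]
    refine Finset.sum_le_sum fun v _ => ?_
    split_ifs with hv
    · refine List.length_pos_iff.2 fun hnil => hv ?_
      exact (hL.buckets v).eq_nil_iff.2 hnil
    · exact Nat.zero_le _
  have hcard' : S.card * (100 * h + 300) ≤ 2 * m * (100 * h + 300) := Nat.mul_le_mul_right _ hcard
  obtain ⟨K, hK⟩ : ∃ K, K = 100 * h + 300 := ⟨_, rfl⟩
  simp only [← hK] at hT hQ hcard'
  clear_value S
  refine Runs.seq (Runs.of_vc (by simp; omega) ?_)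
  refine ⟨by simp; omega, fun T₁ hT₁ => ?_⟩
  simp only [Cmd.bound, NExp.cost, NExp.val] at hT₁ ⊢
  refine Runs.seq (runs_treeLeavesCmd (n := n) (by simpa) (by simp) hW (by omega) ?_)
  intro s₂ T₂ hf₂ h3₂ h4₂ hl₂ hT₂
  have hf₂' : Frame {3, 4, 7} {7, 8} ∅ s₀ s₂ := Frame.trans (by simpa using Frame.refl _ _ _ _) hf₂
    subset_rfl subset_rfl subset_rfl
  simp only [State.nreg_putN, State.narr_putN] at h4₂ hl₂
  refine Runs.seq (runs_treeBuildCmd (n := n) (S := S) (by rw [hf₂'.nreg 0 (by decide), hn]) hn0 h3₂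
    (by simp +contextual [hS]) ?_ hW (by omega) ?_)
  · intro v hv
    rw [hl₂ v hv]
    by_cases h0 : s₀.narr 4 v = 0 <;> simp [h0, hS, hv]
  intro s₃ T₃ hf₃ h4₃ ht₃ hT₃
  have hf₃' := hf₂'.trans hf₃ subset_rfl subset_rfl subset_rfl
  have hr₃ : s₃.rarr 0 = s₂.rarr 0 := hf₃.rarr 0 (by decide)
  refine runs_treeExtractCmd (n := n) (h := h) (S₀ := S) (w := w)
    (by rw [hf₃'.nreg 0 (by decide), hn]) hn0 (by rw [h4₃, h4₂]; simpa using h4) hh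
    (fun v => by rw [hf₃'.rarr 0 (by decide), hw]) (by rw [hr₃]; exact ht₃) hW
    (by rw [← hK]; omega) ?_
  rintro s₄ T₄ hf₄ ⟨o, ho1, ho2, ho3, ho4⟩ hT₄
  rw [← hK] at hT₄
  refine hQ s₄ T₄ (hf₃'.trans hf₄ subset_rfl subset_rfl subset_rfl) ⟨o, ho1, ho2, ?_, ?_⟩ (by omega)
  · exact ho3.imp fun {a b} hab => by linarith [hpos b]
  · intro v u hvu
    obtain ⟨q, hq, -⟩ := hL.exists_mem v u hvu
    refine ho4 v ?_
    simp only [hS, Finset.mem_filter, Finset.mem_range, v.2, true_and]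
    intro h0
    rw [(hL.buckets v).eq_nil_iff.1 h0] at hq
    simp at hq

/-! ### Sorting words by their leading digit -/

/-- The number of digits of `x` in base `n + 1` and its leading digit, as one number. -/
def digitClass (n x : ℕ) : ℕ := Nat.log (n + 1) x * (n + 1) + x / (n + 1) ^ Nat.log (n + 1) x

theorem digitClass_le {n x h : ℕ} (hn : 0 < n) (hh : Nat.log (n + 1) x ≤ h) :
    digitClass n x ≤ h * (n + 1) + n := by
  have h1 : x / (n + 1) ^ Nat.log (n + 1) x < n + 1 := by
    rw [Nat.div_lt_iff_lt_mul (by positivity), ← pow_succ']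
    exact Nat.lt_pow_succ_log_self (by omega) x
  have h2 := Nat.mul_le_mul_right (n + 1) hh
  rw [digitClass]
  omega

/-- Fewer digits mean a smaller number. With equally many digits and leading digits `p ≤ q`, `x` is
below `(q + 1) * B ^ j ≤ 2 * q * B ^ j ≤ 2 * y`, as a leading digit is at least 1. More digits would
give a larger class, as a leading digit is at most `n`. -/
theorem le_two_mul_of_digitClass_le {n x y : ℕ} (hn : 0 < n) (hx : x ≠ 0) (hy : y ≠ 0)
    (h : digitClass n x ≤ digitClass n y) : x ≤ 2 * y := by
  have hb : 1 < n + 1 := by omega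
  have key : ∀ z, z ≠ 0 → 1 ≤ z / (n + 1) ^ Nat.log (n + 1) z ∧
      z / (n + 1) ^ Nat.log (n + 1) z < n + 1 := by
    intro z hz
    constructor
    · exact Nat.div_pos (Nat.pow_log_le_self _ hz) (by positivity)
    · rw [Nat.div_lt_iff_lt_mul (by positivity), ← pow_succ']
      exact Nat.lt_pow_succ_log_self hb z
  obtain ⟨hx1, hx2⟩ := key x hx
  obtain ⟨hy1, hy2⟩ := key y hy
  have hyle := Nat.pow_log_le_self (n + 1) hy
  rw [digitClass, digitClass] at h
  rcases lt_trichotomy (Nat.log (n + 1) x) (Nat.log (n + 1) y) with hl | hl | hl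
  · have h1 := Nat.lt_pow_succ_log_self hb x
    have h2 := Nat.pow_le_pow_right (show 0 < n + 1 by omega) (Nat.succ_le_of_lt hl)
    rw [Nat.succ_eq_add_one] at h1 h2
    omega
  · rw [hl] at h hx1 hx2
    have hle : x / (n + 1) ^ Nat.log (n + 1) y ≤ y / (n + 1) ^ Nat.log (n + 1) y := by omega
    have h3 := Nat.lt_mul_div_succ x (show 0 < (n + 1) ^ Nat.log (n + 1) y by positivity)
    have h4 := Nat.mul_div_le y ((n + 1) ^ Nat.log (n + 1) y)
    have h5 := Nat.mul_le_mul_left ((n + 1) ^ Nat.log (n + 1) y) hle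
    rw [mul_add, mul_one] at h3
    omega
  · have h1 := Nat.mul_le_mul_right (n + 1) (Nat.succ_le_of_lt hl)
    rw [Nat.succ_mul] at h1
    omega

/-- Divide word register `8` by `n + 1` until it is at most `n`, counting in word register `9`. -/
def leadingDigitCmd : Cmd :=
  .loop (.nlt (.reg 0) (.reg 8)) (block [
    .setN 8 (.div (.reg 8) (.add (.reg 0) (.lit 1))),
    .setN 9 (.add (.reg 9) (.lit 1))])

/-- Copy the weights into real array `0` and put each vertex into the bucket of its class. -/
def bucketCmd : Cmd :=
  .loop (.nlt (.reg 3) (.reg 0)) (.seq (block [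
    .storeR 0 (.reg 3) (.ofWord (.get 2 (.reg 3))),
    .setN 8 (.get 2 (.reg 3)),
    .setN 9 (.lit 0)]) (.seq leadingDigitCmd (block [
    .setN 9 (.add (.mul (.reg 9) (.add (.reg 0) (.lit 1))) (.reg 8)),
    .storeN 10 (.add (.reg 3) (.lit 1)) (.get 9 (.reg 9)),
    .storeN 9 (.reg 9) (.add (.reg 3) (.lit 1)),
    .setN 3 (.add (.reg 3) (.lit 1))])))

/-- List the vertices in word array `7`, bucket by bucket. -/
def collectCmd : Cmd :=
  .loop (.nlt (.reg 4) (.reg 0)) (.ite (.neq (.reg 5) (.lit 0))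
    (block [
      .setN 5 (.get 9 (.reg 9)),
      .setN 9 (.add (.reg 9) (.lit 1))])
    (block [
      .storeN 7 (.reg 4) (.sub (.reg 5) (.lit 1)),
      .setN 4 (.add (.reg 4) (.lit 1)),
      .setN 5 (.get 10 (.reg 5))]))

/-- Repeated division by `n + 1` stops exactly when the quotient is a single digit, after `Nat.log
(n + 1) x` rounds. -/
theorem runs_leadingDigitCmd {s₀ : State} {n x h : ℕ} (hn : s₀.nreg 0 = n) (hn0 : 0 < n)
    (h8 : s₀.nreg 8 = x) (h9 : s₀.nreg 9 = 0) (hx : x ≠ 0) (hh : Nat.log (n + 1) x ≤ h)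
    (hW : n + h + 8 ≤ W) (hxW : x < W) {T : ℕ} (hT : 100 * h + 100 ≤ T) {Q : State → ℕ → Prop}
    (hQ : ∀ s T', Frame {8, 9} ∅ ∅ s₀ s → s.nreg 9 = Nat.log (n + 1) x →
      s.nreg 8 = x / (n + 1) ^ Nat.log (n + 1) x → T ≤ T' + (100 * h + 100) → Q s T') :
    Runs W leadingDigitCmd s₀ T Q := by
  have hb : 1 < n + 1 := by omega
  refine Runs.loop (fun s T' => ∃ c ≤ Nat.log (n + 1) x, s.nreg 9 = c ∧
    s.nreg 8 = x / (n + 1) ^ c ∧ Frame {8, 9} ∅ ∅ s₀ s ∧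
    T + 100 * (h - c) ≤ T' + 100 * h ∧ 100 * (h - c) + 100 ≤ T') ?_ ?_
  · rintro s T' ⟨c, hc, hs9, hs8, hfr, hT1, hT2⟩
    have hs0 : s.nreg 0 = n := by rw [hfr.nreg 0 (by decide), hn]
    refine ⟨by simp, by simp; omega, ?_, ?_⟩
    · intro hlt
      simp only [BExp.Holds, NExp.val, hs8, hs0] at hlt
      have hpow : (n + 1) ^ (c + 1) ≤ x := by
        rw [pow_succ']
        exact (Nat.le_div_iff_mul_le (by positivity)).1 hlt
      have hc' : c + 1 ≤ Nat.log (n + 1) x := Nat.le_log_of_pow_le hb hpow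
      have hdiv : x / (n + 1) ^ c / (n + 1) < W :=
        ((Nat.div_le_self _ _).trans (Nat.div_le_self _ _)).trans_lt hxW
      refine Runs.of_vc (by simp; omega) ?_
      simp only [block, Cmd.vc, NExp.val, NExp.Safe]
      simp only [hs0, hs8, hs9, State.nreg_putN]
      refine ⟨⟨trivial, ⟨trivial, by omega, by omega⟩, by omega, hdiv⟩,
        ⟨trivial, by omega, by simp; omega⟩, fun T₁ hT₁ => ?_⟩
      simp at hT₁
      exact ⟨c + 1, hc', by simp, by simp [Nat.div_div_eq_div_mul, pow_succ], by simp [hfr],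
        by omega, by omega⟩
    · intro hlt
      simp only [BExp.Holds, NExp.val, hs8, hs0] at hlt
      obtain rfl : c = Nat.log (n + 1) x := by
        refine le_antisymm hc (Nat.lt_succ_iff.1 (Nat.log_lt_of_lt_pow hx ?_))
        rw [Nat.succ_eq_add_one, pow_succ']
        exact (Nat.div_lt_iff_lt_mul (by positivity)).1 (by omega)
      exact hQ s _ hfr hs9 hs8 (by simp; omega)
  · exact ⟨0, Nat.zero_le _, h9, by simpa using h8, Frame.refl _ _ _ _, by omega, by omega⟩

/-- The linked lists hold the first `e` vertices, sorted into buckets by `κ`; the vertex `i` is held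
in the cell `i + 1`. -/
structure ClassBuckets (κ : ℕ → ℕ) (e : ℕ) (head nxt : ℕ → ℕ) (L : ℕ → List ℕ) : Prop where
  buckets : Buckets head nxt L
  nodup : ∀ d, (L d).Nodup
  mem : ∀ d q, q ∈ L d ↔ ∃ i < e, q = i + 1 ∧ κ i = d

theorem ClassBuckets.push {κ : ℕ → ℕ} {e : ℕ} {head nxt : ℕ → ℕ} {L : ℕ → List ℕ}
    (h : ClassBuckets κ e head nxt L) :
    ∃ L', ClassBuckets κ (e + 1) (Function.update head (κ e) (e + 1))
      (Function.update nxt (e + 1) (head (κ e))) L' := by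
  have hnot : ∀ d, e + 1 ∉ L d := fun d hd => by
    obtain ⟨i, hi, he, -⟩ := (h.mem d _).1 hd
    omega
  refine ⟨_, h.buckets.push (κ e) (Nat.succ_ne_zero e) hnot, fun d => ?_, fun d q => ?_⟩
  · by_cases hd : d = κ e
    · rw [hd, Function.update_self]
      exact List.nodup_cons.2 ⟨hnot _, h.nodup _⟩
    · rw [Function.update_of_ne hd]
      exact h.nodup d
  · rw [mem_update_cons, h.mem]
    constructor
    · rintro (⟨rfl, rfl⟩ | ⟨i, hi, hq⟩)
      · exact ⟨e, by omega, rfl, rfl⟩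
      · exact ⟨i, by omega, hq⟩
    · rintro ⟨i, hi, rfl, rfl⟩
      rcases Nat.lt_succ_iff_lt_or_eq.1 hi with hi | rfl
      · exact .inr ⟨i, hi, rfl, rfl⟩
      · exact .inl ⟨rfl, rfl⟩

theorem runs_bucketCmd {s₀ : State} {n h : ℕ} (hn : s₀.nreg 0 = n) (h3 : s₀.nreg 3 = 0)
    (h9 : s₀.narr 9 = fun _ => 0) (hx : ∀ i < n, s₀.narr 2 i ≠ 0)
    (hh : ∀ i < n, Nat.log (n + 1) (s₀.narr 2 i) ≤ h)
    (hW : h * (n + 1) + n + h + 8 ≤ W) (hxW : ∀ i < n, s₀.narr 2 i < W)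
    {T : ℕ} (hT : n * (100 * h + 300) + 100 ≤ T) {Q : State → ℕ → Prop}
    (hQ : ∀ s T', Frame {3, 8, 9} {9, 10} {0} s₀ s → (∀ i < n, s.rarr 0 i = s₀.narr 2 i) →
      (∃ L, ClassBuckets (fun i => digitClass n (s₀.narr 2 i)) n (s.narr 9) (s.narr 10) L) →
      T ≤ T' + (n * (100 * h + 300) + 100) → Q s T') :
    Runs W bucketCmd s₀ T Q := by
  obtain ⟨K, hK⟩ : ∃ K, K = 100 * h + 300 := ⟨_, rfl⟩
  simp only [← hK] at hT hQ
  refine Runs.loop (fun s T' => ∃ e r, e + r = n ∧ s.nreg 3 = e ∧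
    Frame {3, 8, 9} {9, 10} {0} s₀ s ∧ (∀ i < e, s.rarr 0 i = s₀.narr 2 i) ∧
    (∃ L, ClassBuckets (fun i => digitClass n (s₀.narr 2 i)) e (s.narr 9) (s.narr 10) L) ∧
    T + r * K ≤ T' + n * K ∧ r * K + 100 ≤ T') ?_ ?_
  · rintro s T' ⟨e, r, her, hs3, hfr, hr, ⟨L, hL⟩, hT1, hT2⟩
    have hs0 : s.nreg 0 = n := by rw [hfr.nreg 0 (by decide), hn]
    have hs2 : s.narr 2 = s₀.narr 2 := hfr.narr 2 (by decide)
    refine ⟨by simp, by simp; omega, ?_, ?_⟩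
    · intro hlt
      simp only [BExp.Holds, NExp.val, hs3, hs0] at hlt
      obtain ⟨r, rfl⟩ : ∃ r', r = r' + 1 := ⟨r - 1, by omega⟩
      rw [Nat.succ_mul] at hT1 hT2
      refine Runs.seq (Runs.of_vc (by simp; omega) ?_)
      simp only [block, Cmd.vc, NExp.val, NExp.Safe, RExp.val, RExp.Safe]
      simp only [State.nreg_putRArr, State.narr_putRArr, hs3, hs2]
      refine ⟨trivial, trivial, trivial, by omega, fun T₁ hT₁ => ?_⟩
      simp at hT₁
      refine Runs.seq (runs_leadingDigitCmd (n := n) (x := s₀.narr 2 e) (h := h) (by simp [hs0])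
        (by omega) (by simp) (by simp) (hx e hlt) (hh e hlt) (by omega) (hxW e hlt) (by omega) ?_)
      intro s₂ T₂ hf₂ h9₂ h8₂ hT₂
      have hf₃ : Frame {3, 8, 9} {9, 10} {0} s₀ s₂ := by
        refine Frame.trans ?_ hf₂ (by simp) (by simp) (by simp)
        simp [hfr]
      have h3₂ : s₂.nreg 3 = e := by rw [hf₂.nreg 3 (by decide)]; simp [hs3]
      have h0₂ : s₂.nreg 0 = n := by rw [hf₃.nreg 0 (by decide), hn]
      have h9a : s₂.narr 9 = s.narr 9 := by rw [hf₂.narr 9 (by decide)]; simp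
      have h10a : s₂.narr 10 = s.narr 10 := by rw [hf₂.narr 10 (by decide)]; simp
      have hr₂ : s₂.rarr 0 = Function.update (s.rarr 0) e (s₀.narr 2 e : ℝ) := by
        rw [hf₂.rarr 0 (by decide)]; simp
      have hle := digitClass_le (by omega) (hh e hlt)
      have hle' := Nat.mul_le_mul_right (n + 1) (hh e hlt)
      refine Runs.of_vc (by simp; omega) ?_
      obtain ⟨L', hL'⟩ := hL.push
      have hcl : s₂.nreg 9 * (n + 1) + s₂.nreg 8 = digitClass n (s₀.narr 2 e) := by
        rw [h9₂, h8₂, digitClass]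
      simp only [Cmd.vc, NExp.val, NExp.Safe]
      simp [h3₂, h0₂, hcl, h9a, h10a, hf₃, hr₂]
      refine ⟨⟨⟨?_, ?_⟩, by omega⟩, ⟨by omega, by omega⟩, fun T₃ hT₃ => ⟨r, by omega, ?_, ⟨L', hL'⟩, by omega,
        by omega⟩⟩
      · omega
      · rw [h9₂]; omega
      · intro i hi
        by_cases hie : i = e
        · rw [hie, Function.update_self]
        · rw [Function.update_of_ne hie, hr i (by omega)]
    · intro hlt
      simp only [BExp.Holds, NExp.val, hs3, hs0] at hlt
      obtain rfl : r = 0 := by omega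
      obtain rfl : e = n := by omega
      exact hQ s _ hfr hr ⟨L, hL⟩ (by simp; omega)
  · exact ⟨0, n, by omega, h3, Frame.refl _ _ _ _, by simp,
      ⟨fun _ => [], fun b => by simp [Chain, h9], by simp, by simp⟩, by omega, by omega⟩

/-- Each round either opens a bucket or outputs a vertex, so there are at most `D + 1 + n` rounds.
-/
theorem runs_collectCmd {s₀ : State} {n D : ℕ} {κ : ℕ → ℕ} {L : ℕ → List ℕ}
    (hn : s₀.nreg 0 = n) (h4 : s₀.nreg 4 = 0) (h5 : s₀.nreg 5 = 0) (h9 : s₀.nreg 9 = 0)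
    (hL : ClassBuckets κ n (s₀.narr 9) (s₀.narr 10) L) (hκ : ∀ i < n, κ i ≤ D)
    (hW : D + n + 8 ≤ W) {T : ℕ} (hT : 100 * D + 100 * n + 200 ≤ T) {Q : State → ℕ → Prop}
    (hQ : ∀ s T', Frame {4, 5, 9} {7} ∅ s₀ s →
      (∃ o : List (Fin n), Lists (s.narr 7) (s.nreg 4) o ∧ o.Nodup ∧
        o.Pairwise (fun a b : Fin n => κ a ≤ κ b) ∧ ∀ v, v ∈ o) →
      T ≤ T' + (100 * D + 100 * n + 200) → Q s T') :
    Runs W collectCmd s₀ T Q := by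
  -- Here `o` is the output, `l` the unread rest of the current bucket, `c` the concatenation of the
  -- first `d` buckets, and `r` the number of vertices still to be output.
  refine Runs.loop (fun s T' => ∃ (o : List (Fin n)) (l c : List ℕ) (d r : ℕ),
    o.length + r = n ∧ d ≤ D + 1 ∧ s.nreg 9 = d ∧
    Frame {4, 5, 9} {7} ∅ s₀ s ∧ Lists (s.narr 7) (s.nreg 4) o ∧ c = o.map (fun v : Fin n => (v : ℕ) + 1) ++ l ∧
    Chain (s₀.narr 10) (s.nreg 5) l ∧ c.Nodup ∧ c.Pairwise (fun a b => κ (a - 1) ≤ κ (b - 1)) ∧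
    (∀ q, q ∈ c ↔ ∃ i < n, q = i + 1 ∧ κ i < d) ∧
    T + 100 * (D + 1 - d) + 100 * r ≤ T' + 100 * D + 100 * n + 100 ∧
    100 * (D + 1 - d) + 100 * r + 100 ≤ T') ?_ ?_
  · rintro s T' ⟨o, l, c, d, r, hor, hdD, hs9, hfr, ho, hc, hl, hnd, hpw, hmem, hT1, hT2⟩
    have hs0 : s.nreg 0 = n := by rw [hfr.nreg 0 (by decide), hn]
    have hs9' : s.narr 9 = s₀.narr 9 := hfr.narr 9 (by decide)
    have hs10 : s.narr 10 = s₀.narr 10 := hfr.narr 10 (by decide)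
    have hk := ho.length_eq
    refine ⟨by simp, by simp; omega, ?_, ?_⟩
    · intro hlt
      simp only [BExp.Holds, NExp.val, hs0] at hlt
      obtain ⟨r, rfl⟩ : ∃ r', r = r' + 1 := ⟨r - 1, by omega⟩
      refine Runs.ite (by simp; omega) (by simp; omega) ?_ ?_
      · intro hp
        simp only [BExp.Holds, NExp.val] at hp
        rw [hp] at hl
        obtain rfl : l = [] := hl.eq_nil_iff.1 rfl
        rw [List.append_nil] at hc
        -- If all buckets had been opened and the last one read, every vertex would be in `o`,
        -- although fewer than `n` have been output.
        have hdD' : d < D + 1 := by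
          by_contra hd
          have hsub : ∀ v : Fin n, v ∈ o := by
            intro v
            have : (v : ℕ) + 1 ∈ c := (hmem _).2 ⟨v, v.2, rfl, by have := hκ v v.2; omega⟩
            rw [hc, List.mem_map] at this
            obtain ⟨u, hu, he⟩ := this
            rwa [← Fin.ext (Nat.succ_injective he)]
          have := Finset.card_le_card (fun v _ => List.mem_toFinset.2 (hsub v) :
            (Finset.univ : Finset (Fin n)) ⊆ o.toFinset)
          rw [Finset.card_univ, Fintype.card_fin] at this
          have := o.toFinset_card_le
          omega
        refine Runs.of_vc (by simp; omega) ?_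
        simp only [block, Cmd.vc, NExp.val, NExp.Safe]
        simp only [State.nreg_putN, State.narr_putN, hs9, hs9']
        refine ⟨trivial, ⟨trivial, by omega, by simp; omega⟩, fun T₁ hT₁ => ?_⟩
        simp at hT₁
        refine ⟨o, L d, c ++ L d, d + 1, r + 1, hor, by omega, by simp, by simp [hfr],
          by simpa using ho, by rw [hc], by simpa using hL.buckets d, ?_, ?_, ?_,
          by omega, by omega⟩
        · rw [List.nodup_append]
          refine ⟨hnd, hL.nodup d, ?_⟩
          rintro a ha b hb rfl
          obtain ⟨i, -, rfl, h1⟩ := (hmem a).1 ha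
          obtain ⟨j, -, h2, h3⟩ := (hL.mem d _).1 hb
          obtain rfl : i = j := Nat.succ_injective h2
          omega
        · rw [List.pairwise_append]
          refine ⟨hpw, List.pairwise_of_forall_mem_list ?_, ?_⟩
          · intro a ha b hb
            obtain ⟨i, -, rfl, h1⟩ := (hL.mem d _).1 ha
            obtain ⟨j, -, rfl, h2⟩ := (hL.mem d _).1 hb
            simp only [Nat.add_sub_cancel]
            omega
          · intro a ha b hb
            obtain ⟨i, -, rfl, h1⟩ := (hmem a).1 ha
            obtain ⟨j, -, rfl, h2⟩ := (hL.mem d _).1 hb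
            simp only [Nat.add_sub_cancel]
            omega
        · intro q
          rw [List.mem_append, hmem, hL.mem]
          constructor
          · rintro (⟨i, hi, hq, h⟩ | ⟨i, hi, hq, h⟩)
            · exact ⟨i, hi, hq, by omega⟩
            · exact ⟨i, hi, hq, by omega⟩
          · rintro ⟨i, hi, hq, h⟩
            rcases Nat.lt_succ_iff_lt_or_eq.1 h with h | h
            · exact .inl ⟨i, hi, hq, h⟩
            · exact .inr ⟨i, hi, hq, h⟩
      · intro hp
        simp only [BExp.Holds, NExp.val] at hp
        obtain ⟨l', rfl, hl'⟩ := hl.exists_cons hp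
        obtain ⟨i, hi, hq, -⟩ := (hmem (s.nreg 5)).1 (by rw [hc]; simp)
        refine Runs.of_vc (by simp; omega) ?_
        simp only [block, Cmd.vc, NExp.val, NExp.Safe]
        simp only [State.nreg_putN, State.narr_putN, State.nreg_putNArr, State.narr_putNArr, hs10]
        refine ⟨trivial, ⟨trivial, by omega, by omega⟩, ⟨trivial, by omega, by omega⟩,
          by simp, fun T₁ hT₁ => ?_⟩
        simp at hT₁
        refine ⟨o ++ [⟨i, hi⟩], l', c, d, r, by simp; omega, hdD, by simpa using hs9, by simp [hfr],
          ?_, ?_, ?_, hnd, hpw, hmem, by omega, by omega⟩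
        · simpa [hq] using ho.snoc ⟨i, hi⟩
        · rw [hc, hq]; simp
        · simpa [hs10] using hl'
    · intro hlt
      simp only [BExp.Holds, NExp.val, hs0] at hlt
      have hcn : (o.map fun v : Fin n => (v : ℕ) + 1).Nodup := by
        rw [hc] at hnd
        exact (List.nodup_append.1 hnd).1
      have hon : o.Nodup := List.Nodup.of_map _ hcn
      refine hQ s _ hfr ⟨o, ho, hon, ?_, ?_⟩ (by simp; omega)
      · rw [hc, List.pairwise_append, List.pairwise_map] at hpw
        simpa using hpw.1
      · intro v
        have h1 := List.toFinset_card_of_nodup hon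
        have h2 : o.toFinset = Finset.univ := by
          rw [← Finset.card_eq_iff_eq_univ, Fintype.card_fin]
          have := o.toFinset.card_le_univ
          rw [Fintype.card_fin] at this
          omega
        rw [← List.mem_toFinset, h2]
        exact Finset.mem_univ v
  · exact ⟨[], [], [], 0, n, by simp, by omega, h9, Frame.refl _ _ _ _, by simp [Lists, h4],
      by simp, by simpa [Chain] using h5, by simp, by simp, by simp, by omega, by omega⟩

/-- Copy the weights into real array `0` and write the vertices into word array `7`, by increasing
class. -/
def wordSortCmd : Cmd :=
  block [.setN 3 (.lit 0), bucketCmd, .setN 9 (.lit 0), collectCmd]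

theorem runs_wordSortCmd {s₀ : State} {n h : ℕ} {G : SimpleGraph (Fin n)} {w : Fin n → ℕ}
    (hn : s₀.nreg 0 = n) (hn0 : 0 < n) (h4 : s₀.nreg 4 = 0) (h5 : s₀.nreg 5 = 0)
    (h9 : s₀.narr 9 = fun _ => 0) (hw : ∀ v : Fin n, s₀.narr 2 v = w v) (hpos : ∀ v, 1 ≤ w v)
    (hh : ∀ v, Nat.log (n + 1) (w v) ≤ h)
    (hW : h * (n + 1) + 2 * n + h + 8 ≤ W) (hxW : ∀ v, w v < W)
    {T : ℕ} (hT : 100 * (h * (n + 1)) + n * (100 * h + 500) + 400 ≤ T) {Q : State → ℕ → Prop}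
    (hQ : ∀ s T', Frame {3, 4, 5, 8, 9} {7, 9, 10} {0} s₀ s →
      (∀ v : Fin n, s.rarr 0 v = w v) →
      (∃ o : List (Fin n), Lists (s.narr 7) (s.nreg 4) o ∧ NearlySorted G (fun v => (w v : ℝ)) o) →
      T ≤ T' + (100 * (h * (n + 1)) + n * (100 * h + 500) + 400) → Q s T') :
    Runs W wordSortCmd s₀ T Q := by
  have hw' : ∀ i (hi : i < n), s₀.narr 2 i = w ⟨i, hi⟩ := fun i hi => hw ⟨i, hi⟩
  have e1 : n * (100 * h + 500) = n * (100 * h + 300) + 200 * n := by ring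
  simp only [e1] at hT hQ
  refine Runs.seq (Runs.of_vc (by simp; omega) ?_)
  refine ⟨by simp; omega, fun T₁ hT₁ => ?_⟩
  simp only [Cmd.bound, NExp.cost, NExp.val] at hT₁ ⊢
  refine Runs.seq (runs_bucketCmd (n := n) (h := h) (by simpa) (by simp) (by simpa) ?_ ?_
    (by omega) ?_ (by omega) ?_)
  · intro i hi
    simp only [State.narr_putN, hw' i hi]
    have := hpos ⟨i, hi⟩
    omega
  · intro i hi
    simp only [State.narr_putN, hw' i hi]
    exact hh _
  · intro i hi
    simp only [State.narr_putN, hw' i hi]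
    exact hxW _
  rintro s₂ T₂ hf₂ hr₂ ⟨L, hL⟩ hT₂
  have hf₂' : Frame {3, 4, 5, 8, 9} {7, 9, 10} {0} s₀ s₂ :=
    Frame.trans (by simpa using Frame.refl _ _ _ _) hf₂ (by simp; decide) (by simp) subset_rfl
  simp only [State.narr_putN] at hr₂ hL
  refine Runs.seq (Runs.of_vc (by simp; omega) ?_)
  refine ⟨by simp; omega, fun T₃ hT₃ => ?_⟩
  simp only [Cmd.bound, NExp.cost, NExp.val] at hT₃ ⊢
  refine runs_collectCmd (n := n) (D := h * (n + 1) + n) (L := L)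
    (κ := fun i => digitClass n (s₀.narr 2 i)) ?_ ?_ ?_ (by simp) (by simpa using hL) ?_ (by omega)
    (by omega) ?_
  · simp [hf₂.nreg 0, hn]
  · simp [hf₂.nreg 4, h4]
  · simp [hf₂.nreg 5, h5]
  · intro i hi
    simp only [hw' i hi]
    exact digitClass_le hn0 (hh _)
  rintro s₄ T₄ hf₄ ⟨o, ho1, ho2, ho3, ho4⟩ hT₄
  refine hQ s₄ T₄ ?_ ?_ ⟨o, ho1, ho2, ho3.imp ?_, fun v _ _ => ho4 v⟩ (by omega)
  · exact Frame.trans (by simpa using hf₂') hf₄ (by decide) (by decide) (by simp)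
  · intro v
    rw [hf₄.rarr 0 (by simp)]
    simp [hr₂ v v.2, hw]
  · intro a b hab
    simp only [hw] at hab
    have := le_two_mul_of_digitClass_le hn0 (by have := hpos a; omega) (by have := hpos b; omega) hab
    exact_mod_cast this

/-! ### The greedy star system -/

/-- Make every vertex its own cluster. -/
def labelCmd : Cmd :=
  .loop (.nlt (.reg 3) (.reg 0)) (block [
    .storeN 3 (.reg 3) (.reg 3),
    .setN 3 (.add (.reg 3) (.lit 1))])

/-- Find the lightest vertex that may receive a leaf in the adjacency list at word register `5`, and
write it into word register `6`. -/
def scanCmd : Cmd :=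
  .loop (.not (.neq (.reg 5) (.lit 0))) (block [
    .setN 8 (.get 6 (.reg 5)),
    .ite (.and (.neq (.get 11 (.reg 8)) (.lit 0))
        (.and (.rlt (.get 1 (.reg 8)) (.get 0 (.reg 8)))
        (.and (.not (.rlt (.ofWord (.lit 1))
          (.mul (.mul (.ofWord (.lit 4)) (.reg 0)) (.get 0 (.reg 8)))))
        (.not (.and (.not (.neq (.reg 6) (.reg 0)))
          (.not (.rlt (.get 0 (.reg 8)) (.get 0 (.reg 6)))))))))
      (.setN 6 (.reg 8)) .skip,
    .setN 5 (.get 5 (.reg 5))])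

/-- Attach the vertex in word register `7` to the vertex in word register `6`, if there is one. -/
def attachCmd : Cmd :=
  .ite (.neq (.reg 6) (.reg 0)) .skip (block [
    .storeN 3 (.reg 7) (.reg 6),
    .storeR 1 (.reg 6) (.add (.get 1 (.reg 6)) (.get 0 (.reg 7))),
    .storeN 12 (.reg 6) (.lit 1)])

/-- Process the vertices in word array `7` one after the other. -/
def processCmd : Cmd :=
  .loop (.nlt (.reg 3) (.reg 4)) (.seq (block [
    .setN 7 (.get 7 (.reg 3)),
    .storeN 11 (.reg 7) (.lit 1),
    .setN 3 (.add (.reg 3) (.lit 1))])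
    (.ite (.neq (.get 12 (.reg 7)) (.lit 0))
      (block [block [.setN 6 (.reg 0), .setN 5 (.get 4 (.reg 7))], scanCmd, attachCmd])
      .skip))

/-- Compute a system of stars from the order in word array `7`. -/
def greedyCmd : Cmd :=
  block [.setN 3 (.lit 0), labelCmd, .setN 3 (.lit 0), processCmd]

theorem runs_labelCmd {s₀ : State} {n : ℕ} (hn : s₀.nreg 0 = n) (h3 : s₀.nreg 3 = 0)
    (hW : n + 8 ≤ W) {T : ℕ} (hT : 100 * n + 100 ≤ T) {Q : State → ℕ → Prop}
    (hQ : ∀ s T', Frame {3} {3} ∅ s₀ s → (∀ v < n, s.narr 3 v = v) →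
      T ≤ T' + (100 * n + 100) → Q s T') :
    Runs W labelCmd s₀ T Q := by
  refine Runs.loop (fun s T' => ∃ e ≤ n, s.nreg 3 = e ∧ Frame {3} {3} ∅ s₀ s ∧
    (∀ v < e, s.narr 3 v = v) ∧
    T + 100 * (n - e) ≤ T' + 100 * n ∧ 100 * (n - e) + 100 ≤ T') ?_ ?_
  · rintro s T' ⟨e, he, hs3, hfr, hl, hT1, hT2⟩
    have hs0 : s.nreg 0 = n := by rw [hfr.nreg 0 (by decide), hn]
    refine ⟨by simp, by simp; omega, ?_, ?_⟩
    · intro hlt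
      simp only [BExp.Holds, NExp.val, hs3, hs0] at hlt
      refine Runs.of_vc (by simp; omega) ?_
      refine ⟨trivial, trivial, ⟨trivial, by simp; omega, by simp; omega⟩, fun T₁ hT₁ => ?_⟩
      simp at hT₁
      refine ⟨e + 1, hlt, by simp [hs3], by simp [hfr], ?_, by omega, by omega⟩
      intro v hv
      rcases Nat.lt_succ_iff_lt_or_eq.1 hv with hv | rfl
      · simp [hs3, Function.update_of_ne hv.ne, hl v hv]
      · simp [hs3]
    · intro hlt
      simp only [BExp.Holds, NExp.val, hs3, hs0] at hlt
      obtain rfl : e = n := by omega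
      exact hQ s _ hfr hl (by simp; omega)
  · exact ⟨0, by omega, h3, Frame.refl _ _ _ _, by simp, by omega, by omega⟩

/-- A running minimum over the eligible neighbours, where the value `n` in word register `6` means
that none has been found; the cost is proportional to the degree. -/
theorem runs_scanCmd {s₀ : State} {n m : ℕ} {G : SimpleGraph (Fin n)} {L : ℕ → List ℕ}
    {w : Fin n → ℝ} {E : Fin n → Prop} {v : Fin n}
    (hn : s₀.nreg 0 = n) (h6 : s₀.nreg 6 = n) (h5 : s₀.nreg 5 = s₀.narr 4 v)
    (hw : ∀ v : Fin n, s₀.rarr 0 v = w v)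
    (hL : AdjacencyLists G m (s₀.narr 4) (s₀.narr 5) (s₀.narr 6) L)
    (hE : ∀ u : Fin n, E u ↔
      s₀.narr 11 u = 0 ∧ s₀.rarr 1 u < s₀.rarr 0 u ∧ ¬ 1 < 4 * s₀.rreg 0 * s₀.rarr 0 u)
    (hW : 8 ≤ W) {T : ℕ} (hT : 100 * (L v).length + 100 ≤ T) {Q : State → ℕ → Prop}
    (hQ : ∀ s T', Frame {5, 6, 8} ∅ ∅ s₀ s →
      ((s.nreg 6 = n ∧ ∀ u, G.Adj v u → ¬ E u) ∨
        ∃ b : Fin n, s.nreg 6 = b ∧ G.Adj v b ∧ E b ∧ ∀ u, G.Adj v u → E u → w b ≤ w u) →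
      T ≤ T' + (100 * (L v).length + 100) → Q s T') :
    Runs W scanCmd s₀ T Q := by
  refine Runs.loop (fun s T' => ∃ d l, L v = d ++ l ∧ Chain (s₀.narr 5) (s.nreg 5) l ∧
    Frame {5, 6, 8} ∅ ∅ s₀ s ∧
    ((s.nreg 6 = n ∧ ∀ q ∈ d, ∀ u : Fin n, s₀.narr 6 q = u → ¬ E u) ∨
      ∃ b : Fin n, s.nreg 6 = b ∧ G.Adj v b ∧ E b ∧
        ∀ q ∈ d, ∀ u : Fin n, s₀.narr 6 q = u → E u → w b ≤ w u) ∧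
    T + 100 * l.length ≤ T' + 100 * (L v).length ∧ 100 * l.length + 100 ≤ T') ?_ ?_
  · rintro s T' ⟨d, l, hdl, hl, hfr, hbest, hT1, hT2⟩
    have hs0 : s.nreg 0 = n := by rw [hfr.nreg 0 (by decide), hn]
    have ha5 : s.narr 5 = s₀.narr 5 := hfr.narr 5 (by decide)
    have ha6 : s.narr 6 = s₀.narr 6 := hfr.narr 6 (by decide)
    have ha11 : s.narr 11 = s₀.narr 11 := hfr.narr 11 (by decide)
    have hr0 : s.rarr 0 = s₀.rarr 0 := hfr.rarr 0 (by decide)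
    have hr1 : s.rarr 1 = s₀.rarr 1 := hfr.rarr 1 (by decide)
    have hrr : s.rreg = s₀.rreg := hfr.rreg
    refine ⟨by simp; omega, by simp; omega, ?_, ?_⟩
    · intro hp
      simp only [BExp.Holds, NExp.val] at hp
      obtain ⟨l', rfl, hl'⟩ := hl.exists_cons hp
      obtain ⟨u, hu, hvu⟩ := hL.adj v (s.nreg 5) (by rw [hdl]; simp)
      rw [List.length_cons] at hT1 hT2
      have hdl' : L v = (d ++ [s.nreg 5]) ++ l' := by rw [hdl]; simp
      have hu' : ∀ x : Fin n, s₀.narr 6 (s.nreg 5) = x → x = u := fun x hx =>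
        Fin.ext (by rw [← hx, hu])
      have h1W : 1 < W := by omega
      have h4W : 4 < W := by omega
      have h0W : 0 < W := by omega
      refine Runs.of_vc (by simp; omega) ?_
      simp only [block, Cmd.vc, NExp.val, NExp.Safe, BExp.Safe, BExp.Holds, RExp.Safe, RExp.val]
      simp only [State.nreg_putN, State.narr_putN, State.rarr_putN, State.rreg_putN, ha6, hu, ha11,
        hr0, hr1, hrr, hs0, ha5, h1W, h4W, h0W, if_true, and_self, true_and]
      simp only [show (6 : ℕ) ≠ 8 by decide, show (5 : ℕ) ≠ 8 by decide,
        show (0 : ℕ) ≠ 8 by decide, show (5 : ℕ) ≠ 6 by decide, if_false, Nat.cast_one,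
        Nat.cast_ofNat]
      refine ⟨fun hc T₁ hT₁ => ?_, fun hc T₁ hT₁ => ?_⟩ <;> simp at hT₁
      · have hEu : E u := (hE u).2 ⟨hc.1, hc.2.1, hc.2.2.1⟩
        refine ⟨d ++ [s.nreg 5], l', hdl', by simpa using hl', by simp [hfr],
          .inr ⟨u, by simp, hvu, hEu, ?_⟩, by omega, by omega⟩
        intro q hq x hx hEx
        rcases List.mem_append.1 hq with hq | hq
        · rcases hbest with ⟨-, hno⟩ | ⟨b, hb, -, -, hmin⟩
          · exact (hno q hq x hx hEx).elim
          · refine le_trans ?_ (hmin q hq x hx hEx)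
            have h2 := hc.2.2.2
            rw [hb] at h2
            have h3 : (b : ℕ) ≠ n := b.2.ne
            have h4 : s₀.rarr 0 u < s₀.rarr 0 b := by
              by_contra h4
              exact h2 ⟨h3, h4⟩
            rw [hw, hw] at h4
            exact h4.le
        · rw [List.mem_singleton] at hq
          rw [hu' x (by rw [← hq, hx])]
      · refine ⟨d ++ [s.nreg 5], l', hdl', by simpa using hl', by simp [hfr], ?_,
          by omega, by omega⟩
        rcases hbest with ⟨hb, hno⟩ | ⟨b, hb, hvb, hEb, hmin⟩
        · refine .inl ⟨by simpa using hb, fun q hq x hx hEx => ?_⟩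
          rcases List.mem_append.1 hq with hq | hq
          · exact hno q hq x hx hEx
          · rw [List.mem_singleton] at hq
            rw [hu' x (by rw [← hq, hx])] at hEx
            obtain ⟨e1, e2, e3⟩ := (hE u).1 hEx
            exact hc ⟨e1, e2, e3, fun h => h.1 hb⟩
        · refine .inr ⟨b, by simpa using hb, hvb, hEb, fun q hq x hx hEx => ?_⟩
          rcases List.mem_append.1 hq with hq | hq
          · exact hmin q hq x hx hEx
          · rw [List.mem_singleton] at hq
            rw [hu' x (by rw [← hq, hx])] at hEx ⊢
            obtain ⟨e1, e2, e3⟩ := (hE u).1 hEx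
            by_contra hlt
            refine hc ⟨e1, e2, e3, fun h => h.2 ?_⟩
            rw [hb, hw, hw]
            exact not_le.1 hlt
    · intro hp
      simp only [BExp.Holds, NExp.val, not_not] at hp
      obtain rfl : l = [] := hl.eq_nil_iff.1 hp
      rw [List.append_nil] at hdl
      refine hQ s _ hfr ?_ (by simp at hT1 ⊢; omega)
      rcases hbest with ⟨hb, hno⟩ | ⟨b, hb, hvb, hEb, hmin⟩
      · refine .inl ⟨hb, fun u hu => ?_⟩
        obtain ⟨q, hq, hqu⟩ := hL.exists_mem v u hu
        exact hno q (by rwa [← hdl]) u hqu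
      · refine .inr ⟨b, hb, hvb, hEb, fun u hu => ?_⟩
        obtain ⟨q, hq, hqu⟩ := hL.exists_mem v u hu
        exact hmin q (by rwa [← hdl]) u hqu
  · exact ⟨[], L v, rfl, by rw [h5]; exact hL.buckets v, Frame.refl _ _ _ _,
      .inl ⟨h6, by simp⟩, by omega, by omega⟩

theorem Lists.apply_length {n : ℕ} {ord : ℕ → ℕ} {k : ℕ} {d l : List (Fin n)} {v : Fin n}
    (h : Lists ord k (d ++ v :: l)) : ord d.length = v := by
  have hk := h.length_eq
  have hlt : d.length < k := by
    rw [← hk]; simp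
  have := congrArg (fun x : List ℕ => x[d.length]?) h
  simpa [hlt] using this

/-- The memory represents the system of stars `f` after the vertices of `D` have been processed. -/
structure Represents {n : ℕ} (w : Fin n → ℝ) (f : Fin n → Fin n) (D : Set (Fin n)) (s : State) :
    Prop where
  label : ∀ v : Fin n, s.narr 3 v = f v
  load : ∀ u : Fin n, s.rarr 1 u = ∑ x ∈ leaves f u, w x
  processed : ∀ v : Fin n, s.narr 11 v = 0 ↔ v ∉ D
  center : ∀ u : Fin n, s.narr 12 u = 0 ↔ leaves f u = ∅

theorem runs_processCmd {s₀ : State} {n m : ℕ} {G : SimpleGraph (Fin n)} {L : ℕ → List ℕ}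
    {w : Fin n → ℝ} {lam : ℝ} {o : List (Fin n)} (hlam : s₀.rreg 0 = lam)
    (hn : s₀.nreg 0 = n) (h3 : s₀.nreg 3 = 0) (hw : ∀ v : Fin n, s₀.rarr 0 v = w v)
    (hpos : ∀ v, 0 < w v)
    (hL : AdjacencyLists G m (s₀.narr 4) (s₀.narr 5) (s₀.narr 6) L)
    (ho : Lists (s₀.narr 7) (s₀.nreg 4) o) (hsort : NearlySorted G w o)
    (hs₀ : Represents w id ∅ s₀)
    (hW : n + 8 ≤ W) {T : ℕ}
    (hT : (o.map fun v : Fin n => 100 * (L v).length + 400).sum + 100 ≤ T) {Q : State → ℕ → Prop}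
    (hQ : ∀ s T', (∃ f : Fin n → Fin n, (∀ v : Fin n, s.narr 3 v = (f v : ℕ)) ∧ GreedyInv G w lam f {v | v ∈ o}) → Q s T') :
    Runs W processCmd s₀ T Q := by
  have hon : o.length ≤ n := by simpa using hsort.nodup.length_le_card
  refine Runs.loop (fun s T' => ∃ d l f, o = d ++ l ∧ s.nreg 3 = d.length ∧
    Frame {3, 5, 6, 7, 8} {3, 11, 12} {1} s₀ s ∧ Represents w f {v | v ∈ d} s ∧
    GreedyInv G w lam f {v | v ∈ d} ∧
    (l.map fun v : Fin n => 100 * (L v).length + 400).sum + 100 ≤ T') ?_ ?_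
  · rintro s T' ⟨d, l, f, hdl, hs3, hfr, hrep, hinv, hT'⟩
    have hs0 : s.nreg 0 = n := by rw [hfr.nreg 0 (by decide), hn]
    have hs4 : s.nreg 4 = o.length := by rw [hfr.nreg 4 (by decide), ho.length_eq]
    have ha4 : s.narr 4 = s₀.narr 4 := hfr.narr 4 (by decide)
    have ha5 : s.narr 5 = s₀.narr 5 := hfr.narr 5 (by decide)
    have ha6 : s.narr 6 = s₀.narr 6 := hfr.narr 6 (by decide)
    have ha7 : s.narr 7 = s₀.narr 7 := hfr.narr 7 (by decide)
    have hr0 : s.rarr 0 = s₀.rarr 0 := hfr.rarr 0 (by decide)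
    have hrr : s.rreg 0 = lam := by rw [hfr.rreg, hlam]
    refine ⟨by simp, by simp; omega, ?_, ?_⟩
    · intro hlt
      simp only [BExp.Holds, NExp.val, hs3, hs4] at hlt
      obtain ⟨v, l, rfl⟩ : ∃ v l', l = v :: l' := by
        cases l with
        | nil => simp [hdl] at hlt
        | cons v l => exact ⟨v, l, rfl⟩
      rw [List.map_cons, List.sum_cons] at hT'
      have hv : s₀.narr 7 d.length = v := by rw [hdl] at ho; exact ho.apply_length
      have hnd := hsort.nodup
      have hpw := hsort.sorted
      rw [hdl, List.nodup_append] at hnd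
      rw [hdl, List.pairwise_append, List.pairwise_cons] at hpw
      have hvd : v ∉ d := fun h => hnd.2.2 v h v (by simp) rfl
      -- The vertex `v` is marked as processed before the scan, so eligibility refers to the set
      -- that already contains `v`.
      have hD : ({x | x ∈ d ++ [v]} : Set (Fin n)) = insert v {x | x ∈ d} := by
        ext x; simp [or_comm]
      have hbefore : ∀ a ∈ ({x | x ∈ d} : Set (Fin n)), w a ≤ 2 * w v := fun a ha =>
        hpw.2.2 a ha v (by simp)
      -- A neighbour is not isolated, so it occurs in the order; being unprocessed, it comes after
      -- `v`.
      have hafter : ∀ u, G.Adj v u → u ∉ insert v ({x | x ∈ d} : Set (Fin n)) → w v ≤ 2 * w u := by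
        intro u hvu hu
        refine hpw.2.1.1 u ?_
        have := hsort.mem u v hvu.symm
        rw [hdl, List.mem_append, List.mem_cons] at this
        rcases this with h | h | h
        · exact (hu (.inr h)).elim
        · exact (hu (.inl h)).elim
        · exact h
      have hdl' : o = (d ++ [v]) ++ l := by rw [hdl]; simp
      refine Runs.seq (Runs.of_vc (by simp; omega) ?_)
      simp only [block, Cmd.vc, NExp.val, NExp.Safe]
      simp only [State.nreg_putN, State.nreg_putNArr, hs3, ha7, hv, if_true]
      refine ⟨trivial, trivial, by omega, ⟨by simp, by omega, by simp; omega⟩,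
        fun T₁ hT₁ => ?_⟩
      simp only [show (3 : ℕ) ≠ 7 by decide, if_false]
      simp at hT₁
      set s₁ := ((s.putN 7 v).putNArr 11 v 1).putN 3 (d.length + 1) with hs₁
      have hf₁ : Frame {3, 5, 6, 7, 8} {3, 11, 12} {1} s₀ s₁ := by simp [hs₁, hfr]
      have h3₁ : s₁.nreg 3 = d.length + 1 := by simp [hs₁]
      have h7₁ : s₁.nreg 7 = v := by simp [hs₁]
      have h0₁ : s₁.nreg 0 = n := by simp [hs₁, hs0]
      have hrep₁ : Represents w f {x | x ∈ d ++ [v]} s₁ := by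
        refine ⟨fun x => by simp [hs₁, hrep.label], fun x => by simp [hs₁, hrep.load], fun x => ?_,
          fun x => by simp [hs₁, hrep.center]⟩
        rw [hD]
        by_cases hx : x = v
        · simp [hs₁, hx]
        · have hx' : (x : ℕ) ≠ v := fun h => hx (Fin.ext h)
          have := hrep.processed x
          simp [hs₁, hx, Function.update_of_ne hx', this]
      have hr₁ : s₁.rarr 0 = s₀.rarr 0 := by simp [hs₁, hr0]
      have hl₁ : s₁.rreg 0 = lam := by simp [hs₁, hrr]
      have ha₁ : s₁.narr 4 = s₀.narr 4 ∧ s₁.narr 5 = s₀.narr 5 ∧ s₁.narr 6 = s₀.narr 6 := by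
        simp [hs₁, ha4, ha5, ha6]
      clear_value s₁
      have hcen := hrep₁.center v
      refine Runs.ite ⟨trivial, show 0 < W by omega⟩ (by simp; omega) ?_ ?_
      · intro hc
        simp only [BExp.Holds, NExp.val, h7₁] at hc
        have hleaf := hcen.1 hc
        refine Runs.seq (Runs.of_vc (by simp; omega) ?_)
        refine ⟨trivial, trivial, fun T₂ hT₂ => ?_⟩
        simp at hT₂
        refine Runs.seq (runs_scanCmd (n := n) (m := m) (G := G) (L := L) (w := w)
          (E := Eligible w lam f {x | x ∈ d ++ [v]}) (v := v) (by simp [h0₁]) (by simp [h0₁])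
          (by simp [h7₁]) (by simpa [hr₁] using hw) (by simpa [ha₁] using hL) ?_ (by omega)
          (by omega) ?_)
        · intro u
          simp only [State.narr_putN, State.rarr_putN, State.rreg_putN, hrep₁.processed,
            hrep₁.load, hr₁, hw, hl₁, not_lt]
          rfl
        intro s₂ T₃ hf₂ hbest hT₃
        have hf₂' : Frame {3, 5, 6, 7, 8} {3, 11, 12} {1} s₀ s₂ :=
          Frame.trans (by simpa using hf₁) hf₂ (by decide) (by simp) (by simp)
        have h3₂ : s₂.nreg 3 = d.length + 1 := by rw [hf₂.nreg 3 (by decide)]; simpa using h3₁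
        have h7₂ : s₂.nreg 7 = v := by rw [hf₂.nreg 7 (by decide)]; simpa using h7₁
        have h0₂ : s₂.nreg 0 = n := by rw [hf₂'.nreg 0 (by decide), hn]
        have hr₂ : s₂.rarr 0 v = w v := by rw [hf₂'.rarr 0 (by decide), hw]
        have ha3₂ : s₂.narr 3 = s₁.narr 3 := by rw [hf₂.narr 3 (by decide)]; rfl
        have ha11₂ : s₂.narr 11 = s₁.narr 11 := by rw [hf₂.narr 11 (by decide)]; rfl
        have ha12₂ : s₂.narr 12 = s₁.narr 12 := by rw [hf₂.narr 12 (by decide)]; rfl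
        have hr1₂ : s₂.rarr 1 = s₁.rarr 1 := by rw [hf₂.rarr 1 (by decide)]; rfl
        refine Runs.of_vc (by simp [attachCmd]; omega) ?_
        refine ⟨by simp, fun hno => ?_, fun hno => ?_⟩
        · simp only [BExp.Holds, NExp.val, h0₂] at hno
          intro T₄ hT₄
          simp [attachCmd] at hT₄
          refine ⟨d ++ [v], l, f, hdl', by simp [h3₂], hf₂', ?_, ?_, by omega⟩
          · exact ⟨by rw [ha3₂]; exact hrep₁.label, by rw [hr1₂]; exact hrep₁.load,
              by rw [ha11₂]; exact hrep₁.processed, by rw [ha12₂]; exact hrep₁.center⟩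
          · rw [hD]
            refine hinv.keep fun u hvu hu => hinv.charged_of_not_eligible hbefore hu ?_
            rcases hbest with ⟨-, h⟩ | ⟨b, hb, -⟩
            · rw [hD] at h
              exact h u hvu
            · exact (b.2.ne (by rw [← hb, hno])).elim
        · simp only [BExp.Holds, NExp.val, h0₂] at hno
          obtain ⟨hb, -⟩ | ⟨b, hb, hvb, hEb, hmin⟩ := hbest
          · exact (hno hb).elim
          rw [hD] at hEb hmin
          refine ⟨trivial, trivial, trivial, ⟨trivial, trivial⟩, trivial, by simp; omega,
            fun T₄ hT₄ => ?_⟩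
          simp [attachCmd] at hT₄
          have hfv := hinv.apply_eq (show v ∉ {x | x ∈ d} from hvd)
          have hbv : b ≠ v := hvb.ne'
          have hne : ∀ {x y : Fin n}, x ≠ y → (x : ℕ) ≠ y := fun h h' => h (Fin.ext h')
          refine ⟨d ++ [v], l, Function.update f v b, hdl', by simp [h3₂], by simp [hf₂'], ?_, ?_,
            by omega⟩
          · refine ⟨fun x => ?_, fun x => ?_, fun x => ?_, fun x => ?_⟩
            · by_cases hx : x = v
              · simp [hx, h7₂, hb]
              · simp [h7₂, ha3₂, hrep₁.label, Function.update_of_ne hx,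
                  Function.update_of_ne (hne hx)]
            · rw [leaves_update hfv]
              by_cases hx : x = b
              · rw [if_pos ⟨hx, hbv⟩, Finset.sum_insert (by simp [mem_leaves, hfv])]
                simp [hx, hb, h7₂, hr₂, hr1₂, hrep₁.load, add_comm]
              · rw [if_neg fun h => hx h.1]
                simp [hb, hr1₂, hrep₁.load, Function.update_of_ne (hne hx)]
            · simpa [ha11₂] using hrep₁.processed x
            · rw [leaves_update hfv]
              by_cases hx : x = b
              · simp [hx, hb, hbv]
              · rw [if_neg fun h => hx h.1]
                simp [hb, ha12₂, hrep₁.center, Function.update_of_ne (hne hx)]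
          · rw [hD]
            exact hinv.assign hpos hvd hleaf hvb hEb (hafter b hvb hEb.1) hbefore hmin
      · intro hc
        simp only [BExp.Holds, NExp.val, h7₁] at hc
        refine Runs.of_vc (by simp; omega) fun T₂ hT₂ => ?_
        simp at hT₂
        refine ⟨d ++ [v], l, f, hdl', by simp [h3₁], hf₁, hrep₁, ?_, by omega⟩
        rw [hD]
        -- A vertex with leaves remains a centre, and its edges to later vertices are charged to
        -- these leaves.
        refine hinv.keep fun u hvu hu => .inr (.inl ⟨?_, hafter u hvu hu⟩)
        exact Finset.nonempty_iff_ne_empty.2 fun h => hc (hcen.2 h)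
    · intro hlt
      simp only [BExp.Holds, NExp.val, hs3, hs4] at hlt
      obtain rfl : l = [] := by
        refine List.eq_nil_of_length_eq_zero ?_
        rw [hdl, List.length_append] at hlt
        omega
      rw [List.append_nil] at hdl
      refine hQ s _ ⟨f, hrep.label, ?_⟩
      rw [hdl]
      exact hinv
  · refine ⟨[], o, id, rfl, h3, Frame.refl _ _ _ _, by simpa using hs₀, ?_, hT⟩
    simpa using GreedyInv.id hpos

theorem runs_greedyCmd {s₀ : State} {n m : ℕ} {G : SimpleGraph (Fin n)} {L : ℕ → List ℕ}
    {w : Fin n → ℝ} {lam : ℝ} {o : List (Fin n)} (hlam : s₀.rreg 0 = lam)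
    (hn : s₀.nreg 0 = n) (hw : ∀ v : Fin n, s₀.rarr 0 v = w v) (hpos : ∀ v, 0 < w v)
    (hL : AdjacencyLists G m (s₀.narr 4) (s₀.narr 5) (s₀.narr 6) L)
    (ho : Lists (s₀.narr 7) (s₀.nreg 4) o) (hsort : NearlySorted G w o)
    (h11 : s₀.narr 11 = fun _ => 0) (h12 : s₀.narr 12 = fun _ => 0) (h1 : s₀.rarr 1 = fun _ => 0)
    (hW : n + 8 ≤ W) {T : ℕ} (hT : 200 * m + 500 * n + 300 ≤ T) {Q : State → ℕ → Prop}
    (hQ : ∀ s T', (∃ f : Fin n → Fin n, (∀ v : Fin n, s.narr 3 v = (f v : ℕ)) ∧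
      GreedyInv G w lam f {v | v ∈ o}) → Q s T') :
    Runs W greedyCmd s₀ T Q := by
  -- Each vertex is processed at most once and its list scanned at most once, so the scans cost in
  -- total a multiple of the degree sum.
  have hsum : (o.map fun v : Fin n => 100 * (L v).length + 400).sum ≤ 200 * m + 400 * n := by
    rw [← List.sum_toFinset _ hsort.nodup]
    refine (Finset.sum_le_sum_of_subset (Finset.subset_univ _)).trans ?_
    rw [Fin.sum_univ_eq_sum_range (fun v => 100 * (L v).length + 400), Finset.sum_add_distrib,
      ← Finset.mul_sum, hL.size]
    simp
    omega
  have hleaves : ∀ u : Fin n, leaves id u = ∅ := fun u =>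
    Finset.eq_empty_of_forall_notMem fun v hv => (mem_leaves.1 hv).2 (mem_leaves.1 hv).1
  refine Runs.seq (Runs.of_vc (by simp; omega) ?_)
  refine ⟨show 0 < W by omega, fun T₁ hT₁ => ?_⟩
  simp at hT₁
  refine Runs.seq (runs_labelCmd (n := n) (by simpa) (by simp) hW (by omega) ?_)
  intro s₂ T₂ hf₂ hl₂ hT₂
  refine Runs.seq (Runs.of_vc (by simp; omega) ?_)
  refine ⟨show 0 < W by omega, fun T₃ hT₃ => ?_⟩
  simp at hT₃
  refine runs_processCmd (n := n) (m := m) (G := G) (L := L) (w := w) (lam := lam) (o := o)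
    (by simp [hf₂.rreg, hlam]) (by simp [hf₂.nreg 0, hn]) (by simp)
    (fun v => by simp [hf₂.rarr 0, hw]) hpos (by simpa [hf₂.narr] using hL)
    (by simpa [hf₂.narr, hf₂.nreg] using ho) hsort ?_ hW (by omega) hQ
  refine ⟨fun v => ?_, fun u => ?_, fun v => ?_, fun u => ?_⟩
  · simpa using hl₂ v v.2
  · simp [hf₂.rarr, h1, hleaves]
  · simp [hf₂.narr, h11]
  · simp [hf₂.narr, h12, hleaves]

/-- The whole algorithm: adjacency lists, an order of the vertices by weight, and greedy stars. -/
def starCmd : Cmd :=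
  block [adjacencyCmd, .ite (.neq (.reg 2) (.lit 1)) wordSortCmd treeSortCmd, greedyCmd]

/-! ### From program runs to the approximation guarantee -/

theorem objective_nonneg {V : Type*} [Fintype V] [DecidableEq V] {G : SimpleGraph V} {w : V → ℝ}
    {lam : ℝ} (hlam : 0 ≤ lam) (hw : ∀ v, 0 < w v) (P : Clustering V) :
    0 ≤ objective G w lam P :=
  Finset.sum_nonneg fun C _ => add_nonneg hlam
    (div_nonneg (by positivity) (Finset.sum_nonneg fun v _ => (hw v).le))

instance : IsProbabilityMeasure coinMeasure := by
  unfold coinMeasure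
  infer_instance

/-- The run ends in the same state for all coins, so the random clustering is the constant `P` and
its expectation is its value. Processing every nonisolated vertex charges every edge, which gives
the ratio 40. -/
theorem approximates_of_runs {n : ℕ} {p : Cmd} {lam : ℝ} {G : SimpleGraph (Fin n)}
    {l : List (Fin n × Fin n)} {w : Weights n} {T : ℕ} {B : ℝ} (hlam : 0 ≤ lam)
    (hw : ∀ v, 0 < w.value v) (hT : (T : ℝ) ≤ B)
    (h : Runs W p (start lam l w) T fun s _ => ∃ f : Fin n → Fin n,
      (∀ v : Fin n, s.narr 3 v = (f v : ℕ)) ∧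
      ∃ D, GreedyInv G w.value lam f D ∧ ∀ v u, G.Adj v u → v ∈ D) :
    Approximates p lam (1 / 169) G l w W B := by
  obtain ⟨t, s, hexec, ht, f, hlabel, D, hinv, hD⟩ := h
  obtain ⟨P, hP⟩ := exists_clustering f
  obtain ⟨Opt, hOpt⟩ := exists_isOptimal G w.value lam
  have hratio := objective_le_mul_objective hw hlam hinv.idem
    (fun v hv => (hinv.attached v hv).2) hinv.load
    (fun a b hab => hinv.charged a (hD a b hab) b hab) P Opt hP
  have hnonneg := objective_nonneg (G := G) hlam hw Opt
  refine ⟨fun _ => P, fun ω => ⟨t, s, hexec ω, ?_, fun v => ?_, fun u v => ?_⟩,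
    integrable_const _, Opt, hOpt, ?_, ?_⟩
  · exact le_trans (by exact_mod_cast ht) hT
  · rw [hlabel]
    exact (f v).2
  · rw [hlabel, hlabel, ← hP]
    exact Fin.val_inj
  · simp only [integral_const, probReal_univ, one_smul]
    linarith
  · simp only [integral_const, probReal_univ, one_smul]
    exact hOpt P

theorem edge_lt {n : ℕ} {l : List (Fin n × Fin n)} : ∀ i < l.length,
    padded (fun i : Fin l.length => ((l.get i).1 : ℕ)) i < n ∧
      padded (fun i : Fin l.length => ((l.get i).2 : ℕ)) i < n := fun i hi => by
  rw [padded_of_lt _ hi, padded_of_lt _ hi]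
  exact ⟨Fin.isLt _, Fin.isLt _⟩

theorem runs_starCmd_reals {n h : ℕ} {lam : ℝ} {G : SimpleGraph (Fin n)}
    {l : List (Fin n × Fin n)} (hl : IsEdgeList G l) {w : Fin n → ℝ} (hn0 : 0 < n)
    (hw : ∀ v, 0 < w v) (hh : n ≤ 2 ^ h) (hW : 4 * l.length + 2 * n + 8 ≤ W) :
    Runs W starCmd (start lam l (.reals w))
      (1000 * n + 1000 * l.length + 200 * (l.length * h) + 1000)
      fun s _ => ∃ f : Fin n → Fin n, (∀ v : Fin n, s.narr 3 v = (f v : ℕ)) ∧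
        ∃ D, GreedyInv G w lam f D ∧ ∀ v u, G.Adj v u → v ∈ D := by
  set s₀ := start lam l (.reals w) with hs₀
  have e1 : 2 * l.length * (100 * h + 300) = 200 * (l.length * h) + 600 * l.length := by ring
  refine Runs.seq (runs_adjacencyCmd (n := n) (m := l.length) rfl rfl rfl (by omega) edge_lt
    (by omega) ?_)
  rintro s₁ T₁ hf₁ ⟨L, hL⟩ hT₁
  have hL := hL.adjacencyLists hl
  have h2₁ : s₁.nreg 2 = 0 := hf₁.nreg 2 (by decide)
  refine Runs.seq (Runs.ite ⟨trivial, show 1 < W by omega⟩ (by simp; omega) ?_ ?_)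
  · intro h1
    simp [h2₁] at h1
  intro _
  simp only [BExp.cost, NExp.cost]
  refine runs_treeSortCmd (n := n) (m := l.length) (h := h) (G := G) (L := L) (w := w)
    (hf₁.nreg 0 (by decide)) hn0 (hf₁.nreg 4 (by decide)) hh ?_ hw hL (by omega) (by omega) ?_
  · intro v
    rw [hf₁.rarr 0 (by decide)]
    exact padded_of_lt w v.2
  rintro s₂ T₂ hf₂ ⟨o, ho, hsort⟩ hT₂
  refine runs_greedyCmd (n := n) (m := l.length) (G := G) (L := L) (w := w) (lam := lam) (o := o)
    ?_ ?_ ?_ hw ?_ ho hsort ?_ ?_ ?_ (by omega) (by omega) ?_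
  · rw [hf₂.rreg, hf₁.rreg]; simp [hs₀, start]
  · rw [hf₂.nreg 0 (by decide), hf₁.nreg 0 (by decide)]; rfl
  · intro v
    rw [hf₂.rarr 0 (by decide), hf₁.rarr 0 (by decide)]
    exact padded_of_lt w v.2
  · rw [hf₂.narr 4 (by decide), hf₂.narr 5 (by decide), hf₂.narr 6 (by decide)]
    exact hL
  · rw [hf₂.narr 11 (by decide), hf₁.narr 11 (by decide)]; rfl
  · rw [hf₂.narr 12 (by decide), hf₁.narr 12 (by decide)]; rfl
  · rw [hf₂.rarr 1 (by decide), hf₁.rarr 1 (by decide)]; rfl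
  · rintro s T' ⟨f, hf, hinv⟩
    exact ⟨f, hf, _, hinv, hsort.mem⟩

theorem runs_starCmd_words {n h : ℕ} {lam : ℝ} {G : SimpleGraph (Fin n)}
    {l : List (Fin n × Fin n)} (hl : IsEdgeList G l) {w : Fin n → ℕ} (hn0 : 0 < n)
    (hw : ∀ v, 1 ≤ w v) (hh : ∀ v, Nat.log (n + 1) (w v) ≤ h) (hwW : ∀ v, w v < W)
    (hW : 4 * l.length + h * (n + 1) + 2 * n + h + 8 ≤ W) :
    Runs W starCmd (start lam l (.words w))
      (1000 * n + 1000 * l.length + 200 * (h * n) + 100 * h + 1500)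
      fun s _ => ∃ f : Fin n → Fin n, (∀ v : Fin n, s.narr 3 v = (f v : ℕ)) ∧
        ∃ D, GreedyInv G (fun v => (w v : ℝ)) lam f D ∧ ∀ v u, G.Adj v u → v ∈ D := by
  set s₀ := start lam l (.words w) with hs₀
  have e1 : n * (100 * h + 500) = 100 * (h * n) + 500 * n := by ring
  have e2 : h * (n + 1) = h * n + h := by ring
  refine Runs.seq (runs_adjacencyCmd (n := n) (m := l.length) rfl rfl rfl (by omega) edge_lt
    (by omega) ?_)
  rintro s₁ T₁ hf₁ ⟨L, hL⟩ hT₁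
  have hL := hL.adjacencyLists hl
  have h2₁ : s₁.nreg 2 = 1 := hf₁.nreg 2 (by decide)
  refine Runs.seq (Runs.ite ⟨trivial, show 1 < W by omega⟩ (by simp; omega) ?_ ?_)
  swap
  · intro h1
    simp [h2₁] at h1
  intro _
  simp only [BExp.cost, NExp.cost]
  refine runs_wordSortCmd (n := n) (h := h) (G := G) (w := w)
    (hf₁.nreg 0 (by decide)) hn0 (hf₁.nreg 4 (by decide)) (hf₁.nreg 5 (by decide))
    (hf₁.narr 9 (by decide)) ?_ hw hh (by omega) hwW (by omega) ?_
  · intro v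
    rw [hf₁.narr 2 (by decide)]
    exact padded_of_lt w v.2
  rintro s₂ T₂ hf₂ hw₂ ⟨o, ho, hsort⟩ hT₂
  refine runs_greedyCmd (n := n) (m := l.length) (G := G) (L := L) (lam := lam) (o := o)
    ?_ ?_ hw₂ (fun v => by exact_mod_cast hw v) ?_ ho hsort ?_ ?_ ?_ (by omega) (by omega) ?_
  · rw [hf₂.rreg, hf₁.rreg]; simp [hs₀, start]
  · rw [hf₂.nreg 0 (by decide), hf₁.nreg 0 (by decide)]; rfl
  · rw [hf₂.narr 4 (by decide), hf₂.narr 5 (by decide), hf₂.narr 6 (by decide)]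
    exact hL
  · rw [hf₂.narr 11 (by decide), hf₁.narr 11 (by decide)]; rfl
  · rw [hf₂.narr 12 (by decide), hf₁.narr 12 (by decide)]; rfl
  · rw [hf₂.rarr 1 (by decide), hf₁.rarr 1 (by decide)]; rfl
  · rintro s T' ⟨f, hf, hinv⟩
    exact ⟨f, hf, _, hinv, hsort.mem⟩

/-- Without edges both sides vanish. An edge forces `n ≥ 2`, and then the natural logarithm is
bounded below by `log 2 > 1 / 2`, which absorbs rounding and additive constants. -/
theorem IsEdgeList.length_mul_clog_le {n : ℕ} {G : SimpleGraph (Fin n)}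
    {l : List (Fin n × Fin n)} (hl : IsEdgeList G l) :
    (l.length : ℝ) * Nat.clog 2 n ≤ 3 * (l.length * Real.log n) ∧
      (l.length : ℝ) ≤ 2 * (l.length * Real.log n) := by
  cases l with
  | nil => simp
  | cons p l =>
    have hA : G.Adj p.1 p.2 := (hl.2 s(p.1, p.2)).1 (by simp)
    have hn : 2 ≤ n := by
      by_contra hlt
      refine hA.ne (Fin.ext ?_)
      have := p.1.2
      have := p.2.2
      omega
    have hlog2 := Real.log_two_gt_d9
    have h2n : Real.log 2 ≤ Real.log n := Real.log_le_log two_pos (by exact_mod_cast hn)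
    have hclog : (Nat.clog 2 n : ℝ) ≤ 3 * Real.log n := by
      have h1 : 2 ^ (Nat.clog 2 n - 1) < n := Nat.pow_pred_clog_lt_self one_lt_two (by omega)
      have h2 : ((Nat.clog 2 n - 1 : ℕ) : ℝ) * Real.log 2 ≤ Real.log n := by
        rw [← Real.log_pow]
        exact Real.log_le_log (by positivity) (by exact_mod_cast h1.le)
      have h3 : 0 < Nat.clog 2 n := Nat.clog_pos one_lt_two hn
      rw [Nat.cast_sub h3] at h2
      push_cast at h2
      nlinarith
    have h0 : (0 : ℝ) ≤ (p :: l).length := Nat.cast_nonneg _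
    constructor <;> nlinarith

end GraphClustering

/-! ### Choosing the word size and the running-time constants -/

theorem theorem1 (lam : ℝ) (hlam0 : 0 ≤ lam) (hlam1 : lam ≤ 1) :
    ∃ p : GraphClustering.Cmd,
      (∃ K : ℕ, ∀ (n : ℕ) (_ : 0 < n) (G : SimpleGraph (Fin n)) (l : List (Fin n × Fin n))
        (_ : GraphClustering.IsEdgeList G l) (w : Fin n → ℝ) (_ : ∀ v, 0 < w v)
        (W : ℕ) (_ : (n + 1) ^ K ≤ W),
        GraphClustering.Approximates p lam (1 / 169) G l (GraphClustering.Weights.reals w) W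
          (K * (n + l.length * Real.log n))) ∧
      (∀ c : ℕ, ∃ K : ℕ, ∀ (n : ℕ) (_ : 0 < n) (G : SimpleGraph (Fin n))
        (l : List (Fin n × Fin n)) (_ : GraphClustering.IsEdgeList G l)
        (w : Fin n → ℕ) (_ : ∀ v, 1 ≤ w v ∧ w v ≤ c * n ^ c)
        (W : ℕ) (_ : (n + 1) ^ K ≤ W),
        GraphClustering.Approximates p lam (1 / 169) G l (GraphClustering.Weights.words w) W
          (K * (n + l.length))) := by
  have hpow : ∀ n k : ℕ, 0 < n → k ≤ (n + 1) ^ k := fun n k hn =>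
    (Nat.lt_pow_self (by omega)).le
  -- `K` is kept opaque so that the power `(n + 1) ^ K` is not expanded.
  obtain ⟨K, hK⟩ : ∃ K : ℕ, K = 3000 := ⟨_, rfl⟩
  refine ⟨GraphClustering.starCmd, ⟨K, ?_⟩, fun c => ⟨600 * c + 3000, ?_⟩⟩
  · intro n hn G l hl w hw W hW
    have hm := hl.length_le
    have hW' : 4 * l.length + 2 * n + 8 ≤ W := by
      -- A hundred factors of `n + 1` supply a constant of at least 100; two more supply `(n + 1) ^
      -- 2`, which dominates the number of edges.
      have h1 := hpow n 100 hn
      have h2 : (n + 1) ^ 102 ≤ (n + 1) ^ K := Nat.pow_le_pow_right (by omega) (by omega)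
      rw [pow_add _ 100 2] at h2
      generalize (n + 1) ^ 100 = x at h1 h2
      generalize (n + 1) ^ K = y at hW h2
      nlinarith
    refine GraphClustering.approximates_of_runs hlam0 hw ?_
      (GraphClustering.runs_starCmd_reals (h := Nat.clog 2 n) hl hn hw
        (Nat.le_pow_clog one_lt_two n) hW')
    obtain ⟨h1, h2⟩ := hl.length_mul_clog_le
    have h3 : (1 : ℝ) ≤ n := by exact_mod_cast hn
    rw [hK]
    push_cast
    nlinarith
  · intro n hn G l hl w hw W hW
    have hm := hl.length_le
    -- Polynomial weights have leading exponent at most `2 * c` in base `n + 1`, which is why `h = 2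
    -- * c` below.
    have hwle : ∀ v, w v ≤ (n + 1) ^ (2 * c) := by
      intro v
      calc w v ≤ c * n ^ c := (hw v).2
        _ ≤ (n + 1) ^ c * (n + 1) ^ c :=
          Nat.mul_le_mul (hpow n c hn) (Nat.pow_le_pow_left (by omega) c)
        _ = _ := by rw [two_mul, pow_add]
    have hW' : 4 * l.length + 2 * c * (n + 1) + 2 * n + 2 * c + 8 ≤ W := by
      have h1 := hpow n (100 + 4 * c) hn
      have h2 : (n + 1) ^ (100 + 4 * c + 2) ≤ (n + 1) ^ (600 * c + 3000) :=
        Nat.pow_le_pow_right (by omega) (by omega)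
      rw [pow_add _ (100 + 4 * c) 2] at h2
      generalize (n + 1) ^ (100 + 4 * c) = x at h1 h2
      generalize (n + 1) ^ (600 * c + 3000) = y at hW h2
      have h3 : (100 + 4 * c) * (n + 1) ^ 2 ≤ y := (Nat.mul_le_mul_right _ h1).trans h2
      nlinarith [Nat.zero_le (c * n), Nat.zero_le (c * (n * n))]
    refine GraphClustering.approximates_of_runs hlam0
      (fun v => Nat.cast_pos.2 (hw v).1) ?_
      (GraphClustering.runs_starCmd_words (h := 2 * c) hl hn (fun v => (hw v).1) (fun v => ?_)
        (fun v => ?_) hW')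
    -- With `h = 2 * c`, the terms `200 * (h * n)` and `100 * h` sum to at most `600 * c * n`; this
    -- explains the coefficient of `c` in the constant.
    · have h3 : (1 : ℝ) ≤ n := by exact_mod_cast hn
      have h4 : (c : ℝ) ≤ c * n := le_mul_of_one_le_right (Nat.cast_nonneg _) h3
      have h5 : (0 : ℝ) ≤ c * l.length := by positivity
      have h6 : (0 : ℝ) ≤ l.length := by positivity
      push_cast
      nlinarith
    · refine (Nat.log_mono_right (hwle v)).trans ?_
      rw [Nat.log_pow (by omega)]
    · refine ((hwle v).trans_lt (Nat.pow_lt_pow_right (by omega) ?_)).trans_le hW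
      omega
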